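/- Let $k$ be an algebraically closed field and let $Q$ be a finite quiver with vertices $Q_0=\{v_0,\dots,v_{n_0}\}$ and arrows $Q_1=\{\alpha_1,\dots,\alpha_{n_1}\}$, an arrow $\alpha$ having source $s(\alpha)$ and target $t(\alpha)$; assume $n_0+n_1\ge 1$. Let $kQ$ be the path algebra, $J$ its two-sided ideal generated by the arrows, and $T_2Q=kQ/J^2$. For a finite-dimensional unital $k$-algebra $B$ let $\mathrm{AlgGr}_m(B)\subseteq \mathrm{Gr}_m(B)$ be the variety of $m$-dimensional (unital) subalgebras of $B$, a subset of the Grassmannian, and put $\mathrm{msa}(Q)=\mathrm{AlgGr}_{n-1}(T_2Q)$ with $n=\dim_k T_2Q$. Let $V\subseteq T_2Q$ be the span of $(Q_0\setminus\{v_0\})\cup Q_1$, ordered as $v_1<\dots<v_{n_0}<\alpha_1<\dots<\alpha_{n_1}$, let $R=k[v_1,\dots,v_{n_0},\alpha_1,\dots,\alpha_{n_1}]$, and let $N=|Q_0|+|Q_1|-2=n_0+n_1-1$. For $W\in\mathrm{Gr}_N(V)$, a frame of $W$ is an $(N+1)\times N$ matrix whose columns are the coordinates of a basis of $W$, and the coordinate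 $x(F)$ of a frame $F$, for $x\in(Q_0\setminus\{v_0\})\cup Q_1$, is the maximal minor of $F$ obtained by deleting the row of $x$. A polynomial in $R$ vanishes on $W$ if it vanishes at $(x(F))_x$ for every frame $F$ of $W$. (a) The map $A\mapsto A\cap V$ is a closed embedding $\mathrm{msa}(Q)\hookrightarrow\mathrm{Gr}_N(V)$. Its image is the vanishing set of the ideal $X=X_0+X_{1/2}+X_1\subseteq R$, and the homogeneous vanishing ideal of its image (the ideal generated by the homogeneous polynomials that vanish on it) is exactly $X$, where 1. $X_0$ is generated by $v_i^2v_j-(-1)^{j-i-1}v_iv_j^2$ for $1\le i<j\le n_0$, and $v_iv_jv_l$ for $1\le i<j<l\le n_0$; 2. $X_{1/2}$ is generated by $\alpha_iv_j$ for $1\le j\le n_0$ and $v_j\notin\{s(\alpha_i),t(\alpha_i)\}$; by $(v_l-(-1)^{l-j-1}v_j)\alpha_i$ for $1\le j<l\le n_0$ and $\alpha_i$ an arrow from $v_j$ to $v_l$ or from $v_l$ to $v_j$; and by $v_j\alpha_i$ for $1\le j\le n_0$ and $s(\alpha_i)=v_j=t(\alpha_i)$; 3. $X_1$ is generated by $\alpha_i\alpha_j$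 for $\alpha_i$, $\alpha_j$ not parallel (that is, not having both the same source and the same target). (b) The map sending $W$ to the point with homogeneous coordinates $(x(F))_x$, for any frame $F$ of $W$, is an isomorphism of varieties $\mathrm{Gr}_N(V)\cong\mathbb P^N$. (c) For every two-sided ideal $I$ of $kQ$ that is admissible (i.e. $J^{\ell}\subseteq I\subseteq J^2$ for some $\ell\ge2$), sending a subalgebra to its image under the projection $kQ/I\to kQ/J^2=T_2Q$ defines an isomorphism of varieties $\mathrm{AlgGr}_{d-1}(kQ/I)\cong\mathrm{msa}(Q)$, where $d=\dim_k kQ/I$. -/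

import Mathlib

open Topology

namespace SubalgebraVariety

/-! ### Spaces with functions

Varieties over an algebraically closed field `k` are described by their points: a set with a
topology and, for every point `x`, the `k`-valued functions that are regular near `x`. A function
is regular on an open set `U` when it is regular at every point of `U`. -/

/-- A topological space with a subsheaf of the sheaf of `k`-valued functions. The functions are
written as total functions; only their germs matter, by the first law, and the second law says
that regularity at a point is regularity in a neighbourhood of that point. -/
structure FunctionSpace (k : Type*) (X : Type*) where
  /-- the (Zariski) topology -/
  top : TopologicalSpace X
  /-- `RegularAt f x`: the function `f` is regular in a neighbourhood of `x` -/
  RegularAt : (X → k) → X → Prop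
  congr : ∀ (f g : X → k) (x : X), RegularAt f x → (∀ᶠ y in @nhds X top x, f y = g y) →
    RegularAt g x
  spread : ∀ (f : X → k) (x : X), RegularAt f x → ∀ᶠ y in @nhds X top x, RegularAt f y

section Morphisms

variable {k X Y : Type*}

/-- Morphisms: continuous maps which pull regular functions back to regular functions. -/
def IsMorphism (𝒳 : FunctionSpace k X) (𝒴 : FunctionSpace k Y) (φ : X → Y) : Prop :=
  @Continuous X Y 𝒳.top 𝒴.top φ ∧
    ∀ (x : X) (g : Y → k), 𝒴.RegularAt g (φ x) → 𝒳.RegularAt (g ∘ φ) x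

/-- Isomorphisms: morphisms with an inverse morphism. -/
def IsIsomorphism (𝒳 : FunctionSpace k X) (𝒴 : FunctionSpace k Y) (φ : X → Y) : Prop :=
  IsMorphism 𝒳 𝒴 φ ∧ ∃ ψ : Y → X, IsMorphism 𝒴 𝒳 ψ ∧
    Function.LeftInverse ψ φ ∧ Function.RightInverse ψ φ

/-- The structure on `X` induced by a map `i : X → Y` (used for injective `i`, in particular for
inclusions of open and of closed subsets): the induced topology, with the functions that are
locally pulled back from regular functions on `Y`. -/
def FunctionSpace.induced (𝒴 : FunctionSpace k Y) (i : X → Y) : FunctionSpace k X where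
  top := TopologicalSpace.induced i 𝒴.top
  RegularAt f x := ∃ g : Y → k, 𝒴.RegularAt g (i x) ∧
    ∀ᶠ z in @nhds X (TopologicalSpace.induced i 𝒴.top) x, f z = g (i z)
  congr := by
    rintro f f' x ⟨g, hg, hfg⟩ h
    exact ⟨g, hg, by filter_upwards [hfg, h] with z h1 h2 using h2 ▸ h1⟩
  spread := by
    rintro f x ⟨g, hg, hfg⟩
    let _ := 𝒴.top
    let _ := TopologicalSpace.induced i 𝒴.top
    have h1 : ∀ᶠ z in 𝓝 x, 𝒴.RegularAt g (i z) :=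
      (continuous_induced_dom.tendsto x).eventually (𝒴.spread g (i x) hg)
    filter_upwards [h1, hfg.eventually_nhds] with z hz hz' using ⟨g, hz, hz'⟩

/-- The quotient structure on `Y` along a (surjective) map `π : X → Y`: the quotient topology,
and a function is regular on an open set `U` when its pullback is regular on `π ⁻¹' U`. -/
def FunctionSpace.quotient (𝒳 : FunctionSpace k X) (π : X → Y) : FunctionSpace k Y where
  top := TopologicalSpace.coinduced π 𝒳.top
  RegularAt f y := ∀ᶠ z in @nhds Y (TopologicalSpace.coinduced π 𝒳.top) y,
    ∀ x : X, π x = z → 𝒳.RegularAt (f ∘ π) x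
  congr := by
    intro f f' y h hff'
    let _ := 𝒳.top
    let _ := TopologicalSpace.coinduced π 𝒳.top
    filter_upwards [h, hff'.eventually_nhds] with z hz hz' x hx
    subst hx
    exact 𝒳.congr _ _ x (hz x rfl) ((continuous_coinduced_rng.tendsto x).eventually hz')
  spread := by
    intro f y h
    let _ := TopologicalSpace.coinduced π 𝒳.top
    exact h.eventually_nhds

/-- Closed embeddings: the image is closed, and the map is an isomorphism onto its image, with
the structure induced from the target. -/
def IsClosedEmbeddingOfVarieties (𝒳 : FunctionSpace k X) (𝒴 : FunctionSpace k Y) (φ : X → Y) : Prop :=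
  @IsClosed Y 𝒴.top (Set.range φ) ∧
    IsIsomorphism 𝒳 (𝒴.induced (Subtype.val : Set.range φ → Y)) (Set.rangeFactorization φ)

end Morphisms

section Varieties

variable (k : Type*) [Field k]

/-- The value at `x` of a polynomial in the linear functionals on `E`. -/
noncomputable def polyEval {k : Type*} [Field k] {E : Type*} [AddCommGroup E] [Module k E]
    (p : MvPolynomial (Module.Dual k E) k) (x : E) : k :=
  MvPolynomial.eval (fun l : Module.Dual k E => l x) p

/-- The Zariski topology on a finite-dimensional vector space, generated by the principal open
sets. -/
def zariski (E : Type*) [AddCommGroup E] [Module k E] : TopologicalSpace E :=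
  TopologicalSpace.generateFrom
    {U | ∃ p : MvPolynomial (Module.Dual k E) k, U = {x | polyEval p x ≠ 0}}

/-- A finite-dimensional vector space as an affine space: the regular functions are locally
quotients of polynomial functions. -/
def affineSpace (E : Type*) [AddCommGroup E] [Module k E] : FunctionSpace k E where
  top := zariski k E
  RegularAt f x := ∃ p q : MvPolynomial (Module.Dual k E) k, polyEval q x ≠ 0 ∧
    ∀ᶠ y in @nhds E (zariski k E) x, f y = polyEval p y / polyEval q y
  congr := by
    rintro f g x ⟨p, q, hq, h⟩ hfg
    exact ⟨p, q, hq, by filter_upwards [h, hfg] with y h1 h2 using h2 ▸ h1⟩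
  spread := by
    rintro f x ⟨p, q, hq, h⟩
    let _ := zariski k E
    have ho : IsOpen {y : E | polyEval q y ≠ 0} := TopologicalSpace.isOpen_generateFrom_of_mem
      ⟨q, rfl⟩
    filter_upwards [ho.mem_nhds hq, h.eventually_nhds] with y hy hy' using ⟨p, q, hy, hy'⟩

/-- Projective space, as the quotient of the punctured affine space. -/
noncomputable def projectiveSpace (E : Type*) [AddCommGroup E] [Module k E] :
    FunctionSpace k (Projectivization k E) :=
  ((affineSpace k E).induced (Subtype.val : {x : E // x ≠ 0} → E)).quotient
    (fun x => Projectivization.mk k x.1 x.2)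

/-- The points of the Grassmannian of `m`-dimensional subspaces of a finite-dimensional `V`. -/
def Gr (V : Type*) [AddCommGroup V] [Module k V] (m : ℕ) : Type _ :=
  {W : Submodule k V // Module.finrank k W = m}

/-- The frames: the injective linear maps `k ^ m → V`, as linearly independent families. -/
def Frames (V : Type*) [AddCommGroup V] [Module k V] (m : ℕ) : Type _ :=
  {F : Fin m → V // LinearIndependent k F}

/-- The span of a frame. -/
def frameSpan (V : Type*) [AddCommGroup V] [Module k V] (m : ℕ) (F : Frames k V m) : Gr k V m :=
  ⟨Submodule.span k (Set.range F.1), by simpa using finrank_span_eq_card F.2⟩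

/-- The Grassmannian as a variety: the quotient of the variety of frames, which is an open subset
of an affine space, by the change of frames. -/
def grassmannian (V : Type*) [AddCommGroup V] [Module k V] (m : ℕ) :
    FunctionSpace k (Gr k V m) :=
  ((affineSpace k (Fin m → V)).induced (Subtype.val : Frames k V m → (Fin m → V))).quotient
    (frameSpan k V m)

/-- The points of the variety of `m`-dimensional (unital) subalgebras of `B`. -/
def AlgGr (B : Type*) [Ring B] [Algebra k B] (m : ℕ) : Type _ :=
  {A : Subalgebra k B // Module.finrank k A = m}

/-- A subalgebra as a point of the Grassmannian. -/
def AlgGr.toGr (B : Type*) [Ring B] [Algebra k B] (m : ℕ) (A : AlgGr k B m) : Gr k B m :=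
  ⟨Subalgebra.toSubmodule A.1, A.2⟩

/-- The variety of `m`-dimensional subalgebras, with the structure of a subset of the
Grassmannian. -/
def algGr (B : Type*) [Ring B] [Algebra k B] (m : ℕ) : FunctionSpace k (AlgGr k B m) :=
  (grassmannian k B m).induced (AlgGr.toGr k B m)

end Varieties

section PathAlgebras

/-- The paths of a quiver, with arbitrary endpoints (trivial paths included). -/
abbrev AllPaths (Q₀ : Type*) [Quiver Q₀] : Type _ := Σ (a : Q₀) (b : Q₀), Quiver.Path a b

/-- The path algebra `kQ`: the vector space with basis the paths of the quiver. -/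
def PathAlgebra (k : Type*) [Field k] (Q₀ : Type*) [Quiver Q₀] : Type _ := AllPaths Q₀ →₀ k

variable (k : Type*) [Field k] (Q₀ : Type*) [Quiver Q₀]

noncomputable instance : AddCommGroup (PathAlgebra k Q₀) :=
  inferInstanceAs (AddCommGroup (AllPaths Q₀ →₀ k))

noncomputable instance : Module k (PathAlgebra k Q₀) :=
  inferInstanceAs (Module k (AllPaths Q₀ →₀ k))

variable {Q₀}

/-- A path as an element of the path algebra. -/
noncomputable def ofPath (p : AllPaths Q₀) : PathAlgebra k Q₀ :=
  (Finsupp.single p (1 : k) : AllPaths Q₀ →₀ k)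

open Classical in
/-- The product of two paths: their concatenation (first `p`, then `q`) when `p` ends where `q`
starts, and zero otherwise. -/
noncomputable def pathMul (p q : AllPaths Q₀) : PathAlgebra k Q₀ :=
  if h : p.2.1 = q.1 then ofPath k ⟨p.1, q.2.1, p.2.2.comp (q.2.2.cast h.symm rfl)⟩ else 0

variable (Q₀)

/-- The multiplication of the path algebra, the bilinear extension of the product of paths. -/
noncomputable def mulHom :
    PathAlgebra k Q₀ →ₗ[k] PathAlgebra k Q₀ →ₗ[k] PathAlgebra k Q₀ :=
  Finsupp.linearCombination k (fun p : AllPaths Q₀ =>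
    (Finsupp.linearCombination k (fun q : AllPaths Q₀ => pathMul k p q) :
      PathAlgebra k Q₀ →ₗ[k] PathAlgebra k Q₀))

noncomputable instance : Mul (PathAlgebra k Q₀) := ⟨fun x y => mulHom k Q₀ x y⟩

/-- The identity of the path algebra is the sum of the trivial paths. -/
noncomputable instance [Fintype Q₀] : One (PathAlgebra k Q₀) :=
  ⟨∑ a : Q₀, ofPath k ⟨a, a, Quiver.Path.nil⟩⟩

variable {Q₀}

theorem mul_def (x y : PathAlgebra k Q₀) : x * y = mulHom k Q₀ x y := rfl

theorem one_def [Fintype Q₀] :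
    (1 : PathAlgebra k Q₀) = ∑ a : Q₀, ofPath k ⟨a, a, Quiver.Path.nil⟩ := rfl

theorem mulHom_ofPath (p q : AllPaths Q₀) :
    mulHom k Q₀ (ofPath k p) (ofPath k q) = pathMul k p q := by
  unfold mulHom ofPath
  erw [Finsupp.linearCombination_single, one_smul, Finsupp.linearCombination_single, one_smul]

theorem pathAlgebra_induction {P : PathAlgebra k Q₀ → Prop} (x : PathAlgebra k Q₀)
    (zero : P 0) (add : ∀ x y, P x → P y → P (x + y))
    (path : ∀ (c : k) (p : AllPaths Q₀), P (c • ofPath k p)) : P x := by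
  refine Finsupp.induction_linear (motive := P) x zero add (fun p c => ?_)
  have := path c p
  unfold ofPath at this
  erw [Finsupp.smul_single, smul_eq_mul, mul_one] at this
  exact this

theorem pathMul_comp {a b c : Q₀} (p : Quiver.Path a b) (q : Quiver.Path b c) :
    pathMul k ⟨a, b, p⟩ ⟨b, c, q⟩ = ofPath k ⟨a, c, p.comp q⟩ := by
  simp [pathMul]

theorem pathMul_of_ne {p q : AllPaths Q₀} (h : p.2.1 ≠ q.1) : pathMul k p q = 0 := by
  simp [pathMul, h]

theorem mulHom_assoc_path (p q r : AllPaths Q₀) :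
    mulHom k Q₀ (mulHom k Q₀ (ofPath k p) (ofPath k q)) (ofPath k r) =
      mulHom k Q₀ (ofPath k p) (mulHom k Q₀ (ofPath k q) (ofPath k r)) := by
  obtain ⟨a, b, p⟩ := p
  obtain ⟨b', c, q⟩ := q
  obtain ⟨c', d, r⟩ := r
  rw [mulHom_ofPath, mulHom_ofPath]
  by_cases h : b = b'
  · subst h
    by_cases h' : c = c'
    · subst h'
      simp only [pathMul_comp, mulHom_ofPath, Quiver.Path.comp_assoc]
    · rw [pathMul_comp, mulHom_ofPath, pathMul_of_ne k (by exact h'),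
        pathMul_of_ne k (by exact h'), map_zero]
  · by_cases h' : c = c'
    · subst h'
      rw [pathMul_comp, mulHom_ofPath, pathMul_of_ne k (by exact h),
        pathMul_of_ne k (by exact h), map_zero, LinearMap.zero_apply]
    · rw [pathMul_of_ne k (by exact h), pathMul_of_ne k (by exact h'), map_zero, map_zero,
        LinearMap.zero_apply]

theorem pathAlgebra_mul_assoc (x y z : PathAlgebra k Q₀) : x * y * z = x * (y * z) := by
  simp only [mul_def]
  refine pathAlgebra_induction k (P := fun x => mulHom k Q₀ (mulHom k Q₀ x y) z =
    mulHom k Q₀ x (mulHom k Q₀ y z)) x (by simp) (fun _ _ h1 h2 => by simp [h1, h2]) fun a p => ?_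
  refine pathAlgebra_induction k (P := fun y => mulHom k Q₀ (mulHom k Q₀ (a • ofPath k p) y) z =
    mulHom k Q₀ (a • ofPath k p) (mulHom k Q₀ y z)) y (by simp)
    (fun _ _ h1 h2 => by
      rw [map_add, map_add, LinearMap.add_apply, h1, h2, map_add, LinearMap.add_apply, map_add])
    fun b q => ?_
  refine pathAlgebra_induction k (P := fun z =>
    mulHom k Q₀ (mulHom k Q₀ (a • ofPath k p) (b • ofPath k q)) z =
      mulHom k Q₀ (a • ofPath k p) (mulHom k Q₀ (b • ofPath k q) z)) z (by simp)
    (fun _ _ h1 h2 => by rw [map_add, h1, h2, map_add, map_add]) fun c r => ?_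
  simp only [map_smul, LinearMap.smul_apply, mulHom_assoc_path]

theorem pathAlgebra_one_mul [Fintype Q₀] (x : PathAlgebra k Q₀) : 1 * x = x := by
  simp only [mul_def]
  refine pathAlgebra_induction k (P := fun x => mulHom k Q₀ 1 x = x) x (by simp)
    (fun _ _ h1 h2 => by rw [map_add, h1, h2]) fun a p => ?_
  obtain ⟨s, t, p⟩ := p
  rw [map_smul, one_def, map_sum, LinearMap.sum_apply, Finset.sum_eq_single s]
  · rw [mulHom_ofPath, pathMul_comp, Quiver.Path.nil_comp]
  · intro b _ hb
    rw [mulHom_ofPath, pathMul_of_ne k (by exact hb)]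
  · intro h
    exact absurd (Finset.mem_univ s) h

theorem pathAlgebra_mul_one [Fintype Q₀] (x : PathAlgebra k Q₀) : x * 1 = x := by
  simp only [mul_def]
  refine pathAlgebra_induction k (P := fun x => mulHom k Q₀ x 1 = x) x (by simp)
    (fun _ _ h1 h2 => by rw [map_add, LinearMap.add_apply, h1, h2]) fun a p => ?_
  obtain ⟨s, t, p⟩ := p
  rw [map_smul, LinearMap.smul_apply, one_def, map_sum, Finset.sum_eq_single t]
  · rw [mulHom_ofPath, pathMul_comp, Quiver.Path.comp_nil]
  · intro b _ hb
    rw [mulHom_ofPath, pathMul_of_ne k (by exact hb.symm)]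
  · intro h
    exact absurd (Finset.mem_univ t) h

variable (Q₀)

noncomputable instance [Fintype Q₀] : Ring (PathAlgebra k Q₀) :=
  { (inferInstance : AddCommGroup (PathAlgebra k Q₀)),
    (inferInstance : Mul (PathAlgebra k Q₀)),
    (inferInstance : One (PathAlgebra k Q₀)) with
    left_distrib := fun x y z => by
      change mulHom k Q₀ x (y + z) = mulHom k Q₀ x y + mulHom k Q₀ x z
      rw [map_add]
    right_distrib := fun x y z => by
      change mulHom k Q₀ (x + y) z = mulHom k Q₀ x z + mulHom k Q₀ y z
      rw [map_add, LinearMap.add_apply]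
    zero_mul := fun x => by
      change mulHom k Q₀ 0 x = 0
      rw [map_zero, LinearMap.zero_apply]
    mul_zero := fun x => by
      change mulHom k Q₀ x 0 = 0
      rw [map_zero]
    mul_assoc := pathAlgebra_mul_assoc k
    one_mul := pathAlgebra_one_mul k
    mul_one := pathAlgebra_mul_one k }

noncomputable instance [Fintype Q₀] : Algebra k (PathAlgebra k Q₀) :=
  Algebra.ofModule
    (fun c x y => by
      change mulHom k Q₀ (c • x) y = c • mulHom k Q₀ x y
      rw [map_smul, LinearMap.smul_apply])
    (fun c x y => by
      change mulHom k Q₀ x (c • y) = c • mulHom k Q₀ x y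
      rw [map_smul])

variable {Q₀}

/-- A vertex as an element of the path algebra. -/
noncomputable def vertex (a : Q₀) : PathAlgebra k Q₀ := ofPath k ⟨a, a, Quiver.Path.nil⟩

/-- An arrow as an element of the path algebra. -/
noncomputable def arrow (e : Quiver.Total Q₀) : PathAlgebra k Q₀ :=
  ofPath k ⟨e.left, e.right, e.hom.toPath⟩

variable (Q₀)

/-- The two-sided ideal `J(Q)` of the path algebra generated by the arrows. -/
noncomputable def arrowIdeal [Fintype Q₀] : Ideal (PathAlgebra k Q₀) :=
  (TwoSidedIdeal.span (Set.range (arrow k (Q₀ := Q₀)))).asIdeal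

instance [Fintype Q₀] : (arrowIdeal k Q₀).IsTwoSided :=
  inferInstanceAs ((TwoSidedIdeal.span (Set.range (arrow k (Q₀ := Q₀)))).asIdeal.IsTwoSided)

variable {k Q₀} in
/-- Admissible ideals: `J(Q) ^ ℓ ≤ I ≤ J(Q) ^ 2` for some `ℓ ≥ 2`. -/
structure IsAdmissible [Fintype Q₀] (I : Ideal (PathAlgebra k Q₀)) : Prop where
  le_sq : I ≤ arrowIdeal k Q₀ ^ 2
  pow_le : ∃ l : ℕ, 2 ≤ l ∧ arrowIdeal k Q₀ ^ l ≤ I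

/-- The truncated quiver algebra `T₂Q = kQ / J(Q)²`. -/
abbrev T2 [Fintype Q₀] : Type _ := PathAlgebra k Q₀ ⧸ (arrowIdeal k Q₀ ^ 2)

/-- The points of `msa(Q)`, the subalgebras of codimension one of `T₂Q`. -/
abbrev Msa [Fintype Q₀] : Type _ := AlgGr k (T2 k Q₀) (Module.finrank k (T2 k Q₀) - 1)

/-- `msa(Q)` as a variety. -/
noncomputable abbrev msa [Fintype Q₀] : FunctionSpace k (Msa k Q₀) :=
  algGr k (T2 k Q₀) (Module.finrank k (T2 k Q₀) - 1)

end PathAlgebras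

section Coordinates

/-! The vertices are `v 0, …, v n₀`, the arrows are `α 0, …, α (n₁ - 1)`. The index set
`Fin n₀ ⊕ Fin n₁` stands for `(Q₀ ∖ {v 0}) ∪ Q₁`: `Sum.inl i` is the vertex `v i.succ`, and
`Sum.inr j` is the arrow `α j`; vertices come before arrows. -/

variable (k : Type*) [Field k] {Q₀ : Type*} [Quiver Q₀] [Fintype Q₀] {n₀ n₁ N : ℕ}

/-- The elements of `(Q₀ ∖ {v 0}) ∪ Q₁` in `T₂Q`. -/
noncomputable def gen (v : Fin (n₀ + 1) ≃ Q₀) (α : Fin n₁ ≃ Quiver.Total Q₀) :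
    Fin n₀ ⊕ Fin n₁ → T2 k Q₀ :=
  Sum.elim (fun i => Ideal.Quotient.mk _ (vertex k (v i.succ)))
    (fun j => Ideal.Quotient.mk _ (arrow k (α j)))

/-- The subspace `V` of `T₂Q` spanned by `(Q₀ ∖ {v 0}) ∪ Q₁`. -/
noncomputable def spanV (v : Fin (n₀ + 1) ≃ Q₀) (α : Fin n₁ ≃ Quiver.Total Q₀) :
    Submodule k (T2 k Q₀) :=
  Submodule.span k (Set.range (gen k v α))

variable {k}

/-- The matrix `F` is a frame of the subspace `W` of `V`: its columns are the coordinates, with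
respect to `(Q₀ ∖ {v 0}) ∪ Q₁`, of the members of a basis of `W`. -/
def IsFrame (v : Fin (n₀ + 1) ≃ Q₀) (α : Fin n₁ ≃ Quiver.Total Q₀)
    (F : Matrix (Fin n₀ ⊕ Fin n₁) (Fin N) k) (W : Submodule k (spanV k v α)) : Prop :=
  LinearIndependent k (fun j : Fin N => ∑ x, F x j • gen k v α x) ∧
    Submodule.span k (Set.range fun j : Fin N => ∑ x, F x j • gen k v α x) =
      W.map (spanV k v α).subtype

/-- The position of the elements of `(Q₀ ∖ {v 0}) ∪ Q₁` in the total order. -/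
def position (hN : n₀ + n₁ = N + 1) : Fin n₀ ⊕ Fin n₁ ≃ Fin (N + 1) :=
  finSumFinEquiv.trans (finCongr hN)

/-- The maximal minors of an `(N + 1) × N` matrix, indexed by the deleted row. -/
def minors (hN : n₀ + n₁ = N + 1) (F : Matrix (Fin n₀ ⊕ Fin n₁) (Fin N) k) :
    Fin n₀ ⊕ Fin n₁ → k :=
  fun x => (F.submatrix
    (fun r : Fin N => (position hN).symm ((position hN x).succAbove r)) id).det

/-- The polynomial `f` vanishes on the subspace `W`: it is zero at the maximal minors of every
frame of `W`. -/
def VanishesOn (hN : n₀ + n₁ = N + 1) (v : Fin (n₀ + 1) ≃ Q₀) (α : Fin n₁ ≃ Quiver.Total Q₀)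
    (f : MvPolynomial (Fin n₀ ⊕ Fin n₁) k) (W : Gr k (spanV k v α) N) : Prop :=
  ∀ F : Matrix (Fin n₀ ⊕ Fin n₁) (Fin N) k, IsFrame v α F W.1 →
    MvPolynomial.eval (minors hN F) f = 0

/-- The vanishing set of an ideal. -/
def vanishingSet (hN : n₀ + n₁ = N + 1) (v : Fin (n₀ + 1) ≃ Q₀) (α : Fin n₁ ≃ Quiver.Total Q₀)
    (I : Ideal (MvPolynomial (Fin n₀ ⊕ Fin n₁) k)) : Set (Gr k (spanV k v α) N) :=
  {W | ∀ f ∈ I, VanishesOn hN v α f W}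

/-- The homogeneous vanishing ideal of a set of points: the ideal generated by the homogeneous
polynomials that vanish on it. -/
noncomputable def vanishingIdeal (hN : n₀ + n₁ = N + 1) (v : Fin (n₀ + 1) ≃ Q₀) (α : Fin n₁ ≃ Quiver.Total Q₀)
    (S : Set (Gr k (spanV k v α) N)) : Ideal (MvPolynomial (Fin n₀ ⊕ Fin n₁) k) :=
  Ideal.span {f | (∃ d : ℕ, f.IsHomogeneous d) ∧ ∀ W ∈ S, VanishesOn hN v α f W}

variable (k)

/-- The variable of the vertex `v i.succ`. -/
noncomputable def vVar (n₁ : ℕ) (i : Fin n₀) : MvPolynomial (Fin n₀ ⊕ Fin n₁) k :=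
  MvPolynomial.X (Sum.inl i)

/-- The variable of the arrow `α j`. -/
noncomputable def aVar (n₀ : ℕ) (j : Fin n₁) : MvPolynomial (Fin n₀ ⊕ Fin n₁) k :=
  MvPolynomial.X (Sum.inr j)

/-- The cubic relations between vertices. -/
noncomputable def X0 (n₀ n₁ : ℕ) : Ideal (MvPolynomial (Fin n₀ ⊕ Fin n₁) k) :=
  Ideal.span
    ({f | ∃ i j : Fin n₀, i < j ∧
        f = vVar k n₁ i ^ 2 * vVar k n₁ j -
          (-1) ^ (j.val - i.val - 1) * (vVar k n₁ i * vVar k n₁ j ^ 2)} ∪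
     {f | ∃ i j l : Fin n₀, i < j ∧ j < l ∧ f = vVar k n₁ i * vVar k n₁ j * vVar k n₁ l})

/-- The quadratic relations between a vertex and an arrow. -/
noncomputable def Xhalf (v : Fin (n₀ + 1) ≃ Q₀) (α : Fin n₁ ≃ Quiver.Total Q₀) :
    Ideal (MvPolynomial (Fin n₀ ⊕ Fin n₁) k) :=
  Ideal.span
    ({f | ∃ (i : Fin n₁) (j : Fin n₀), v j.succ ≠ (α i).left ∧ v j.succ ≠ (α i).right ∧
        f = aVar k n₀ i * vVar k n₁ j} ∪
     {f | ∃ (i : Fin n₁) (j l : Fin n₀), j < l ∧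
        (((α i).left = v j.succ ∧ (α i).right = v l.succ) ∨
          ((α i).left = v l.succ ∧ (α i).right = v j.succ)) ∧
        f = (vVar k n₁ l - (-1) ^ (l.val - j.val - 1) * vVar k n₁ j) * aVar k n₀ i} ∪
     {f | ∃ (i : Fin n₁) (j : Fin n₀), (α i).left = v j.succ ∧ (α i).right = v j.succ ∧
        f = vVar k n₁ j * aVar k n₀ i})

/-- The products of two arrows that are not parallel. -/
noncomputable def X1 (n₀ : ℕ) (α : Fin n₁ ≃ Quiver.Total Q₀) :
    Ideal (MvPolynomial (Fin n₀ ⊕ Fin n₁) k) :=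
  Ideal.span {f | ∃ i j : Fin n₁,
    ¬ ((α i).left = (α j).left ∧ (α i).right = (α j).right) ∧ f = aVar k n₀ i * aVar k n₀ j}

end Coordinates

end SubalgebraVariety

open SubalgebraVariety

/-! A hyperplane of `T₂Q` containing `1` is the kernel of a functional `ψ` with `ψ 1 = 0`, unique up
to a scalar. Such a `ψ` is determined by its restriction to `V`, because `T₂Q` is the direct sum of
`V` and the line of `1`. Expanding a determinant shows that the maximal minors of a frame of a
hyperplane of `V` are the values of its functional on the basis, up to a common factor and the signs
`(-1) ^ position` (`minors_eq_smul`). These signs are the only source of the signs in `X`, and the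
substitution `twist` removes them.

The kernel of `ψ` is closed under products exactly when there are vertices `s`, `t` such that `ψ` is
a multiple of `e_s* - e_t*` on vertices and vanishes on all arrows that do not go from `s` to `t`
(`OnCone`). In that case `ψ (a * b) = e_s* a * ψ b + ψ a * e_t* b`, so the kernel is a subalgebra.
Conversely, products of the kernel elements `ψ x' • x - ψ x • x'`, with `x`, `x'` basis elements,
give the equations `ConeRelations`, which force this shape.

The cone is a union of linear spaces. That `X` is its full vanishing ideal follows from
`mul_sub_aeval_mem`: modulo `X`, and after multiplication by a suitable monomial, each variable
equals its image under the linear retraction onto one component. A polynomial vanishing on the cone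
becomes zero under every retraction. Terms with an arrow variable are removed first, then those with
vertices only (`ConeRelations.mem_of_cone`).

For morphisms, the Grassmannian of hyperplanes is compared with the space of nonzero functionals:
frames give functionals by determinants, and functionals locally give frames by explicit polynomial
formulas. Hence taking preimages of hyperplanes under a linear map is a morphism
(`isMorphism_comap`). The embedding and its inverse are the preimages under the inclusion of `V` and
under the projection `projV` killing `1`.

For an admissible ideal, nilpotency of the arrow ideal forces every subalgebra of codimension one to
contain the image of `J ^ 2` (`functional_mul_eq_zero`). The map of (c) is then the preimage under a
linear section of the projection, and its inverse is the preimage under the projection. -/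

namespace SubalgebraVariety

/-! ### Morphisms of spaces with functions, tested pointwise -/

section MorphismsAt

variable {k X Y Z : Type*}

/-- Continuity at `x` together with pull-back of the functions regular near the image of `x`. -/
def IsMorphismAt (𝒳 : FunctionSpace k X) (𝒴 : FunctionSpace k Y) (φ : X → Y) (x : X) : Prop :=
  @ContinuousAt X Y 𝒳.top 𝒴.top φ x ∧
    ∀ g : Y → k, 𝒴.RegularAt g (φ x) → 𝒳.RegularAt (g ∘ φ) x

variable {𝒳 : FunctionSpace k X} {𝒴 : FunctionSpace k Y} {𝒵 : FunctionSpace k Z}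

theorem isMorphism_iff {φ : X → Y} : IsMorphism 𝒳 𝒴 φ ↔ ∀ x, IsMorphismAt 𝒳 𝒴 φ x := by
  let _ := 𝒳.top
  let _ := 𝒴.top
  exact ⟨fun h x => ⟨h.1.continuousAt, h.2 x⟩,
    fun h => ⟨continuous_iff_continuousAt.2 fun x => (h x).1, fun x => (h x).2⟩⟩

theorem IsMorphism.at {φ : X → Y} (h : IsMorphism 𝒳 𝒴 φ) (x : X) : IsMorphismAt 𝒳 𝒴 φ x :=
  isMorphism_iff.1 h x

theorem IsMorphismAt.comp {φ : X → Y} {ψ : Y → Z} {x : X} (hψ : IsMorphismAt 𝒴 𝒵 ψ (φ x))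
    (hφ : IsMorphismAt 𝒳 𝒴 φ x) : IsMorphismAt 𝒳 𝒵 (ψ ∘ φ) x := by
  let _ := 𝒳.top
  let _ := 𝒴.top
  let _ := 𝒵.top
  exact ⟨ContinuousAt.comp hψ.1 hφ.1, fun g hg => hφ.2 _ (hψ.2 g hg)⟩

theorem IsMorphism.comp {φ : X → Y} {ψ : Y → Z} (hψ : IsMorphism 𝒴 𝒵 ψ)
    (hφ : IsMorphism 𝒳 𝒴 φ) : IsMorphism 𝒳 𝒵 (ψ ∘ φ) :=
  isMorphism_iff.2 fun x => (hψ.at _).comp (hφ.at x)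

theorem IsMorphismAt.congr {φ ψ : X → Y} {x : X} (h : IsMorphismAt 𝒳 𝒴 φ x)
    (he : ∀ᶠ y in @nhds X 𝒳.top x, φ y = ψ y) : IsMorphismAt 𝒳 𝒴 ψ x := by
  let _ := 𝒳.top
  let _ := 𝒴.top
  refine ⟨h.1.congr he, fun g hg => 𝒳.congr (g ∘ φ) _ x (h.2 g ?_) ?_⟩
  · rwa [he.self_of_nhds]
  · filter_upwards [he] with y hy
    simp [hy]

theorem isMorphism_induced (𝒴 : FunctionSpace k Y) (i : X → Y) :
    IsMorphism (𝒴.induced i) 𝒴 i := by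
  let _ := 𝒴.top
  exact ⟨continuous_induced_dom, fun x g hg => ⟨g, hg, Filter.Eventually.of_forall fun _ => rfl⟩⟩

theorem IsMorphismAt.into_induced {i : Y → Z} {φ : X → Y} {x : X}
    (h : IsMorphismAt 𝒳 𝒵 (i ∘ φ) x) : IsMorphismAt 𝒳 (𝒵.induced i) φ x := by
  let _ := 𝒳.top
  let _ := 𝒵.top
  let _ := TopologicalSpace.induced i 𝒵.top
  have hc : ContinuousAt φ x := (Topology.IsInducing.mk rfl : IsInducing i).continuousAt_iff.2 h.1
  refine ⟨hc, ?_⟩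
  rintro g ⟨g', hg', he⟩
  refine 𝒳.congr _ _ x (h.2 g' hg') ?_
  filter_upwards [hc.eventually he] with y hy using hy.symm

theorem isMorphism_quotient (𝒳 : FunctionSpace k X) (π : X → Y) :
    IsMorphism 𝒳 (𝒳.quotient π) π := by
  let _ := 𝒳.top
  let _ := TopologicalSpace.coinduced π 𝒳.top
  exact ⟨continuous_coinduced_rng, fun x g hg => hg.self_of_nhds x rfl⟩

/-- Over an open subset, being a morphism may be tested after pulling back to the space of which
the source is a quotient. -/
theorem isMorphismAt_quotient {π : X → Y} {φ : Y → Z} {U : Set Y}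
    (hU : @IsOpen X 𝒳.top (π ⁻¹' U))
    (h : ∀ x, π x ∈ U → IsMorphismAt 𝒳 𝒵 (φ ∘ π) x) {y : Y} (hy : y ∈ U) :
    IsMorphismAt (𝒳.quotient π) 𝒵 φ y := by
  let _ := 𝒳.top
  let _ := 𝒵.top
  let _ : TopologicalSpace Y := TopologicalSpace.coinduced π 𝒳.top
  have hU' : IsOpen U := isOpen_coinduced.2 hU
  have hc : ∀ z ∈ U, ContinuousAt φ z := by
    intro z hz
    refine tendsto_nhds.2 fun O hO hzO => ?_
    have : IsOpen (U ∩ φ ⁻¹' O) := by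
      refine isOpen_coinduced.2 (isOpen_iff_mem_nhds.2 fun x hx => ?_)
      exact Filter.inter_mem (hU.mem_nhds hx.1) ((h x hx.1).1.preimage_mem_nhds (hO.mem_nhds hx.2))
    exact Filter.mem_of_superset (this.mem_nhds ⟨hz, hzO⟩) Set.inter_subset_right
  refine ⟨hc y hy, fun g hg => ?_⟩
  have h1 := (hc y hy).eventually (𝒵.spread g _ hg)
  filter_upwards [h1, hU'.mem_nhds hy] with z hz hzU x hx
  subst hx
  exact (h x hzU).2 g hz

theorem isMorphism_quotient_iff {π : X → Y} {φ : Y → Z} (h : IsMorphism 𝒳 𝒵 (φ ∘ π)) :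
    IsMorphism (𝒳.quotient π) 𝒵 φ := by
  let _ := 𝒳.top
  exact isMorphism_iff.2 fun y => isMorphismAt_quotient (U := Set.univ) isOpen_univ
    (fun x _ => h.at x) trivial

end MorphismsAt

/-! ### Polynomial maps between affine spaces -/

section PolynomialMaps

variable {k : Type*} [Field k] {E E' : Type*} [AddCommGroup E] [Module k E]
  [AddCommGroup E'] [Module k E']

/-- Polynomial functions on a vector space. -/
def IsPoly (f : E → k) : Prop := ∃ p : MvPolynomial (Module.Dual k E) k, ∀ x, polyEval p x = f x

/-- Polynomial maps between vector spaces. -/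
def IsPolyMap (k : Type*) [Field k] {E E' : Type*} [AddCommGroup E] [Module k E]
    [AddCommGroup E'] [Module k E'] (f : E → E') : Prop :=
  ∀ l : Module.Dual k E', IsPoly (k := k) fun x => l (f x)

theorem isPoly_const (c : k) : IsPoly (k := k) (fun _ : E => c) :=
  ⟨MvPolynomial.C c, fun x => by simp [polyEval]⟩

theorem isPoly_dual (l : Module.Dual k E) : IsPoly (fun x => l x) :=
  ⟨MvPolynomial.X l, fun x => by simp [polyEval]⟩

theorem IsPoly.add {f g : E → k} (hf : IsPoly f) (hg : IsPoly g) :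
    IsPoly fun x => f x + g x := by
  obtain ⟨p, hp⟩ := hf
  obtain ⟨q, hq⟩ := hg
  exact ⟨p + q, fun x => by simp [← hp, ← hq, polyEval]⟩

theorem IsPoly.mul {f g : E → k} (hf : IsPoly f) (hg : IsPoly g) :
    IsPoly fun x => f x * g x := by
  obtain ⟨p, hp⟩ := hf
  obtain ⟨q, hq⟩ := hg
  exact ⟨p * q, fun x => by simp [← hp, ← hq, polyEval]⟩

theorem IsPoly.sum {ι : Type*} (s : Finset ι) {f : ι → E → k} (hf : ∀ i ∈ s, IsPoly (f i)) :
    IsPoly fun x => ∑ i ∈ s, f i x := by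
  classical
  induction s using Finset.induction_on with
  | empty => simpa using isPoly_const 0
  | insert a s ha ih =>
    simp only [Finset.sum_insert ha]
    exact (hf a (by simp)).add (ih fun i hi => hf i (by simp [hi]))

theorem IsPoly.prod {ι : Type*} (s : Finset ι) {f : ι → E → k} (hf : ∀ i ∈ s, IsPoly (f i)) :
    IsPoly fun x => ∏ i ∈ s, f i x := by
  classical
  induction s using Finset.induction_on with
  | empty => simpa using isPoly_const 1
  | insert a s ha ih =>
    simp only [Finset.prod_insert ha]
    exact (hf a (by simp)).mul (ih fun i hi => hf i (by simp [hi]))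

theorem IsPoly.det {n : Type*} [Fintype n] [DecidableEq n] {M : E → Matrix n n k}
    (h : ∀ i j, IsPoly fun x => M x i j) : IsPoly fun x => (M x).det := by
  simp only [Matrix.det_apply']
  exact .sum _ fun σ _ => (isPoly_const _).mul (.prod _ fun i _ => h _ _)

theorem isPolyMap_of_basis {ι : Type*} [Finite ι] (c : Module.Basis ι k E') {f : E → E'}
    (h : ∀ i, IsPoly (k := k) fun x => c.repr (f x) i) : IsPolyMap k f := by
  have := Fintype.ofFinite ι
  intro l
  have : (fun x => l (f x)) = fun x => ∑ i, c.repr (f x) i * l (c i) := by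
    ext x
    conv_lhs => rw [← c.sum_repr (f x), map_sum]
    simp only [map_smul, smul_eq_mul]
  rw [this]
  exact .sum _ fun i _ => (h i).mul (isPoly_const _)

theorem isPolyMap_linear (f : E →ₗ[k] E') : IsPolyMap k f := fun l => isPoly_dual (l ∘ₗ f)

/-- The variables on `E'` are the functionals themselves, so it is enough to substitute for each
functional a polynomial representing its pullback. -/
theorem IsPolyMap.pullback {f : E → E'} (hf : IsPolyMap k f)
    (q : MvPolynomial (Module.Dual k E') k) : IsPoly fun x => polyEval q (f x) := by
  choose P hP using hf
  refine ⟨MvPolynomial.aeval P q, fun x => ?_⟩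
  simp only [polyEval, MvPolynomial.aeval_def, ← MvPolynomial.coe_eval₂Hom] at hP ⊢
  rw [← RingHom.comp_apply]
  refine congrArg (fun g : _ →+* k => g q) (MvPolynomial.ringHom_ext (fun r => ?_) fun l => ?_)
  · simp
  · simpa using hP l x

theorem isOpen_ne_zero {f : E → k} (hf : IsPoly f) : @IsOpen E (zariski k E) {x | f x ≠ 0} := by
  obtain ⟨p, hp⟩ := hf
  exact TopologicalSpace.isOpen_generateFrom_of_mem ⟨p, by simp [hp]⟩

theorem isClosed_zero {f : E → k} (hf : IsPoly f) :
    @IsClosed E (zariski k E) {x | f x = 0} := by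
  let _ := zariski k E
  exact ⟨by simpa [Set.compl_ofPred] using isOpen_ne_zero hf⟩

theorem IsPolyMap.isMorphism {f : E → E'} (hf : IsPolyMap k f) :
    IsMorphism (affineSpace k E) (affineSpace k E') f := by
  let _ := zariski k E
  let _ := zariski k E'
  have hc : Continuous f := by
    refine continuous_generateFrom_iff.2 ?_
    rintro _ ⟨p, rfl⟩
    exact isOpen_ne_zero (hf.pullback p)
  refine ⟨hc, ?_⟩
  rintro x g ⟨p, q, hq, h⟩
  obtain ⟨p', hp'⟩ := hf.pullback p
  obtain ⟨q', hq'⟩ := hf.pullback q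
  refine ⟨p', q', by rwa [hq'], ?_⟩
  filter_upwards [hc.continuousAt.eventually h] with y hy
  simp [hy, hp', hq']

/-- A map between subsets of affine spaces given by polynomials is a morphism. -/
theorem IsPolyMap.isMorphismAt_induced {S S' : Type*} {i : S → E} {i' : S' → E'} {f : E → E'}
    (hf : IsPolyMap k f) {φ : S → S'} {x : S}
    (h : ∀ᶠ y in @nhds S (TopologicalSpace.induced i (zariski k E)) x, i' (φ y) = f (i y)) :
    IsMorphismAt ((affineSpace k E).induced i) ((affineSpace k E').induced i') φ x := by
  refine IsMorphismAt.into_induced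
    (IsMorphismAt.congr ((hf.isMorphism.at _).comp ((isMorphism_induced _ i).at x)) ?_)
  filter_upwards [h] with y hy using hy.symm

end PolynomialMaps

/-! ### Grassmannians of hyperplanes through functionals -/

section Hyperplanes

variable (k : Type*) [Field k] (E : Type*) [AddCommGroup E] [Module k E]

/-- The nonzero linear functionals, as a variety. -/
def puncturedDual : FunctionSpace k {φ : Module.Dual k E // φ ≠ 0} :=
  (affineSpace k (Module.Dual k E)).induced Subtype.val

/-- The frames, as a variety. -/
def frameSpace (m : ℕ) : FunctionSpace k (Frames k E m) :=
  (affineSpace k (Fin m → E)).induced (Subtype.val : Frames k E m → (Fin m → E))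

variable {k E} [FiniteDimensional k E] {m : ℕ} (hE : Module.finrank k E = m + 1)

/-- The hyperplane defined by a nonzero functional. -/
def kerPoint (φ : {φ : Module.Dual k E // φ ≠ 0}) : Gr k E m :=
  ⟨LinearMap.ker φ.1, by
    have := Module.Dual.finrank_ker_add_one_of_ne_zero φ.2
    omega⟩

/-- The functional `x ↦ det (x, F)`. -/
noncomputable def detFunctional (b : Module.Basis (Fin (m + 1)) k E) (F : Fin m → E) :
    Module.Dual k E where
  toFun x := b.det.curryLeft x F
  map_add' := by simp
  map_smul' := by simp

omit [FiniteDimensional k E] in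
theorem detFunctional_apply (b : Module.Basis (Fin (m + 1)) k E) (F : Fin m → E) (x : E) :
    detFunctional b F x = b.det (Matrix.vecCons x F) := rfl

omit [FiniteDimensional k E] in
include hE in
-- The determinant of `(x, F)` vanishes exactly when the family is dependent, which for independent
-- `F` means that `x` lies in the span of `F`.
theorem ker_detFunctional (b : Module.Basis (Fin (m + 1)) k E) {F : Fin m → E}
    (hF : LinearIndependent k F) :
    LinearMap.ker (detFunctional b F) = Submodule.span k (Set.range F) := by
  ext x
  have h1 : IsUnit (b.det (Matrix.vecCons x F)) ↔
      LinearIndependent k (Matrix.vecCons x F) := by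
    rw [← Module.Basis.is_basis_iff_det b]
    refine ⟨fun h => h.1, fun h => ⟨h, ?_⟩⟩
    exact h.span_eq_top_of_card_eq_finrank (by simp [hE])
  rw [LinearMap.mem_ker, detFunctional_apply, ← not_iff_not, ← Ne, ← isUnit_iff_ne_zero, h1]
  have := linearIndependent_finCons (K := k) (x := x) (v := F)
  exact this.trans (by simp [hF])

omit [FiniteDimensional k E] in
include hE in
theorem detFunctional_ne_zero (b : Module.Basis (Fin (m + 1)) k E) {F : Fin m → E}
    (hF : LinearIndependent k F) : detFunctional b F ≠ 0 := by
  intro h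
  have h1 := ker_detFunctional hE b hF
  rw [h, LinearMap.ker_zero] at h1
  have h2 := finrank_span_eq_card hF
  rw [← h1, finrank_top, hE] at h2
  simp at h2

omit [FiniteDimensional k E] in
theorem isPolyMap_detFunctional (b : Module.Basis (Fin (m + 1)) k E) :
    IsPolyMap k fun F : Fin m → E => detFunctional b F := by
  refine isPolyMap_of_basis b.dualBasis fun i => ?_
  simp only [Module.Basis.dualBasis_repr, detFunctional_apply, Module.Basis.det_apply]
  refine IsPoly.det fun r c => ?_
  simp only [Module.Basis.toMatrix_apply]
  cases c using Fin.cases with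
  | zero => exact isPoly_const (b.repr (b i) r)
  | succ c => exact isPoly_dual (b.coord r ∘ₗ LinearMap.proj (φ := fun _ : Fin m => E) c)

/-- The functional defining the hyperplane spanned by a frame. -/
noncomputable def frameFunctional (F : Frames k E m) : {φ : Module.Dual k E // φ ≠ 0} :=
  ⟨detFunctional (Module.finBasisOfFinrankEq k E hE) F.1, detFunctional_ne_zero hE _ F.2⟩

theorem kerPoint_frameFunctional (F : Frames k E m) :
    kerPoint hE (frameFunctional hE F) = frameSpan k E m F :=
  Subtype.ext (ker_detFunctional hE _ F.2)

theorem isMorphism_frameFunctional :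
    IsMorphism (frameSpace k E m) (puncturedDual k E) (frameFunctional hE) :=
  isMorphism_iff.2 fun _ => (isPolyMap_detFunctional _).isMorphismAt_induced
    (Filter.Eventually.of_forall fun _ => rfl)

omit [FiniteDimensional k E] in
theorem isOpen_puncturedDual_ne_zero (e : E) :
    @IsOpen _ (puncturedDual k E).top {φ : {φ : Module.Dual k E // φ ≠ 0} | φ.1 e ≠ 0} := by
  let _ := zariski k (Module.Dual k E)
  exact (isOpen_ne_zero (isPoly_dual (Module.Dual.eval k E e))).preimage
    (continuous_induced_dom (f := Subtype.val))

omit [FiniteDimensional k E] in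
-- These vectors lie in the kernel of `φ` and depend polynomially on `φ`, which gives a local
-- section from functionals to frames. In a relation, `φ₀` kills every `u j` and isolates the
-- coefficient of `e`; what remains is a relation among the `u j`.
theorem linearIndependent_localFrame {φ₀ φ : Module.Dual k E} {e : E} {u : Fin m → E}
    (hu : LinearIndependent k u) (hu0 : ∀ j, φ₀ (u j) = 0) (he : φ₀ e ≠ 0) (hφ : φ e ≠ 0) :
    LinearIndependent k fun j => φ e • u j - φ (u j) • e := by
  rw [Fintype.linearIndependent_iff] at hu ⊢
  intro c hc
  have h0 := congrArg φ₀ hc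
  simp only [map_sum, map_smul, map_sub, hu0, smul_eq_mul, mul_zero, zero_sub, mul_neg, map_zero,
    Finset.sum_neg_distrib, neg_eq_zero, ← mul_assoc, ← Finset.sum_mul] at h0
  have h1 : ∑ j, c j * φ (u j) = 0 := (mul_eq_zero.1 h0).resolve_right he
  have h2 : φ e • ∑ j, c j • u j = 0 := by
    simp only [smul_sub, Finset.sum_sub_distrib] at hc
    rw [show ∑ j, c j • φ (u j) • e = (∑ j, c j * φ (u j)) • e by
      simp [Finset.sum_smul, smul_smul], h1, zero_smul, sub_zero] at hc
    rw [Finset.smul_sum, ← hc]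
    exact Finset.sum_congr rfl fun j _ => smul_comm _ _ _
  exact hu c ((smul_eq_zero.1 h2).resolve_left hφ)

omit [FiniteDimensional k E] in
theorem isPolyMap_localFrame {ι : Type*} [Finite ι] (b : Module.Basis ι k E) (e : E)
    (u : Fin m → E) :
    IsPolyMap k fun (φ : Module.Dual k E) j => φ e • u j - φ (u j) • e := by
  refine isPolyMap_of_basis (Pi.basis fun _ : Fin m => b) fun ⟨j, i⟩ => ?_
  have : ∀ φ : Module.Dual k E, ((Pi.basis fun _ : Fin m => b).repr
      (fun j => φ e • u j - φ (u j) • e)) ⟨j, i⟩ =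
      φ e * b.repr (u j) i + φ (u j) * (- b.repr e i) := by
    intro φ
    simp [Pi.basis_repr, sub_eq_add_neg]
  simp only [this]
  exact ((isPoly_dual (Module.Dual.eval k E e)).mul (isPoly_const _)).add
    ((isPoly_dual (Module.Dual.eval k E (u j))).mul (isPoly_const _))

theorem isMorphism_kerPoint : IsMorphism (puncturedDual k E) (grassmannian k E m) (kerPoint hE) := by
  classical
  refine isMorphism_iff.2 fun φ₀ => ?_
  obtain ⟨e, he⟩ : ∃ e, φ₀.1 e ≠ 0 := by
    by_contra! h
    exact φ₀.2 (LinearMap.ext h)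
  let b := Module.finBasisOfFinrankEq k (LinearMap.ker φ₀.1) (kerPoint hE φ₀).2
  let u : Fin m → E := fun j => b j
  have hu : LinearIndependent k u := b.linearIndependent.map' (Submodule.subtype _) (by simp)
  have hu0 : ∀ j, φ₀.1 (u j) = 0 := fun j => (b j).2
  -- The second branch is a dummy value: only the germ at `φ₀` matters, and `φ e ≠ 0` near `φ₀`.
  let G : {φ : Module.Dual k E // φ ≠ 0} → Frames k E m := fun φ =>
    if h : φ.1 e ≠ 0 then ⟨_, linearIndependent_localFrame hu hu0 he h⟩ else ⟨u, hu⟩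
  have hGpos : ∀ φ, φ.1 e ≠ 0 → (G φ).1 = fun j => φ.1 e • u j - φ.1 (u j) • e := by
    intro φ h
    simp only [G]
    exact congrArg Subtype.val (dif_pos h)
  have hnear : ∀ᶠ φ in @nhds _ (puncturedDual k E).top φ₀, φ.1 e ≠ 0 :=
    let _ := (puncturedDual k E).top
    (isOpen_puncturedDual_ne_zero e).mem_nhds he
  have hG : IsMorphismAt (puncturedDual k E) (frameSpace k E m) G φ₀ := by
    refine (isPolyMap_localFrame (Module.finBasis k E) e u).isMorphismAt_induced ?_
    filter_upwards [hnear] with φ hφ using hGpos φ hφ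
  refine (((isMorphism_quotient (frameSpace k E m) (frameSpan k E m)).at (G φ₀)).comp hG).congr ?_
  filter_upwards [hnear] with φ hφ
  refine Subtype.ext (Submodule.eq_of_le_of_finrank_eq ?_ ?_)
  · simp only [Function.comp, frameSpan, kerPoint, hGpos φ hφ]
    rw [Submodule.span_le]
    rintro _ ⟨j, rfl⟩
    simp [mul_comm]
  · exact (frameSpan k E m (G φ)).2.trans (kerPoint hE φ).2.symm

/-- Morphisms on an open part of the Grassmannian of hyperplanes may be tested on functionals. -/
theorem isMorphismAt_grassmannian {Z : Type*} {𝒵 : FunctionSpace k Z} {Θ : Gr k E m → Z}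
    {U : Set (Gr k E m)} (hU : @IsOpen _ (puncturedDual k E).top (kerPoint hE ⁻¹' U))
    (h : ∀ φ, kerPoint hE φ ∈ U → IsMorphismAt (puncturedDual k E) 𝒵 (Θ ∘ kerPoint hE) φ)
    {H : Gr k E m} (hH : H ∈ U) : IsMorphismAt (grassmannian k E m) 𝒵 Θ H := by
  let _ := (frameSpace k E m).top
  let _ := (puncturedDual k E).top
  refine isMorphismAt_quotient (𝒳 := frameSpace k E m) (U := U) ?_ (fun F hF => ?_) hH
  · have : frameSpan k E m ⁻¹' U = frameFunctional hE ⁻¹' (kerPoint hE ⁻¹' U) := by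
      ext F
      simp [kerPoint_frameFunctional]
    rw [this]
    exact hU.preimage (isMorphism_frameFunctional hE).1
  · have : Θ ∘ frameSpan k E m = (Θ ∘ kerPoint hE) ∘ frameFunctional hE := by
      ext F
      simp [kerPoint_frameFunctional]
    rw [this]
    exact (h _ (by rwa [kerPoint_frameFunctional])).comp ((isMorphism_frameFunctional hE).at F)

theorem isMorphism_grassmannian {Z : Type*} {𝒵 : FunctionSpace k Z} {Θ : Gr k E m → Z}
    (h : IsMorphism (puncturedDual k E) 𝒵 (Θ ∘ kerPoint hE)) :
    IsMorphism (grassmannian k E m) 𝒵 Θ := by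
  let _ := (puncturedDual k E).top
  exact isMorphism_iff.2 fun H => isMorphismAt_grassmannian hE (U := Set.univ) isOpen_univ
    (fun φ _ => h.at φ) trivial

theorem frameSpan_surjective : Function.Surjective (frameSpan k E m) := by
  intro H
  let b := Module.finBasisOfFinrankEq k H.1 H.2
  let F : Frames k E m := ⟨fun j => b j, b.linearIndependent.map' (Submodule.subtype _) (by simp)⟩
  refine ⟨F, Subtype.ext (Submodule.eq_of_le_of_finrank_eq ?_ ?_)⟩
  · simp only [frameSpan]
    rw [Submodule.span_le]
    rintro _ ⟨j, rfl⟩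
    exact (b j).2
  · exact (frameSpan k E m F).2.trans H.2.symm

theorem kerPoint_surjective : Function.Surjective (kerPoint hE) := by
  intro H
  obtain ⟨F, rfl⟩ := frameSpan_surjective H
  exact ⟨frameFunctional hE F, kerPoint_frameFunctional hE F⟩

variable {E' : Type*} [AddCommGroup E'] [Module k E'] [FiniteDimensional k E'] {m' : ℕ}

/-- Inverse images of hyperplanes under a linear map define a morphism. -/
theorem isMorphism_comap (hE : Module.finrank k E = m + 1) (hE' : Module.finrank k E' = m' + 1)
    {X Y : Type*} {i : X → Gr k E m} {j : Y → Gr k E' m'}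
    (f : E' →ₗ[k] E) {ψ : X → Y} (h : ∀ x, (j (ψ x)).1 = (i x).1.comap f) :
    IsMorphism ((grassmannian k E m).induced i) ((grassmannian k E' m').induced j) ψ := by
  classical
  refine isMorphism_iff.2 fun x => IsMorphismAt.into_induced ?_
  -- A total extension of the preimage map; its value where the preimage is not a hyperplane is
  -- immaterial.
  let G : Gr k E m → Gr k E' m' := fun H =>
    if hH : Module.finrank k (H.1.comap f) = m' then ⟨_, hH⟩ else j (ψ x)
  have hGpos : ∀ (H : Gr k E m) (hH : Module.finrank k (H.1.comap f) = m'),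
      G H = ⟨H.1.comap f, hH⟩ := fun H hH => dif_pos hH
  have hG : j ∘ ψ = G ∘ i := by
    ext1 y
    have hy : Module.finrank k ((i y).1.comap f) = m' := by rw [← h]; exact (j (ψ y)).2
    exact (Subtype.ext (h y) : _ = (⟨_, hy⟩ : Gr k E' m')).trans (hGpos _ hy).symm
  rw [hG]
  refine IsMorphismAt.comp ?_ ((isMorphism_induced _ i).at x)
  -- On this open set, of the hyperplanes not containing the range of `f`, the preimage of `ker φ`
  -- is the kernel of the nonzero functional `φ ∘ₗ f`.
  let U : Set (Gr k E m) := {H | H.1.comap f ≠ ⊤}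
  have hxU : i x ∈ U := by
    intro htop
    have h1 := (j (ψ x)).2
    rw [h, htop, finrank_top, hE'] at h1
    omega
  have hmem : ∀ φ, kerPoint hE φ ∈ U ↔ φ.1 ∘ₗ f ≠ 0 := by
    intro φ
    rw [ne_eq, ← LinearMap.ker_eq_top, LinearMap.ker_comp]
    rfl
  let _ := (puncturedDual k E).top
  have hUo : IsOpen (kerPoint hE ⁻¹' U) := by
    have : kerPoint hE ⁻¹' U = ⋃ y : E', {φ | φ.1 (f y) ≠ 0} := by
      ext φ
      simp [hmem, LinearMap.ext_iff]
    rw [this]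
    exact isOpen_iUnion fun y => isOpen_puncturedDual_ne_zero _
  refine isMorphismAt_grassmannian hE hUo (fun φ hφ => ?_) hxU
  let P : {φ : Module.Dual k E // φ ≠ 0} → {φ : Module.Dual k E' // φ ≠ 0} := fun χ =>
    if hχ : χ.1 ∘ₗ f ≠ 0 then ⟨_, hχ⟩ else ⟨_, (hmem φ).1 hφ⟩
  have hP : IsMorphismAt (puncturedDual k E) (puncturedDual k E') P φ := by
    refine (isPolyMap_linear f.dualMap).isMorphismAt_induced ?_
    filter_upwards [hUo.mem_nhds hφ] with χ hχ
    have := (hmem χ).1 hχ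
    have h4 : P χ = ⟨_, this⟩ := dif_pos this
    rw [h4]
    rfl
  refine (((isMorphism_kerPoint hE').at (P φ)).comp hP).congr ?_
  filter_upwards [hUo.mem_nhds hφ] with χ hχ
  have h1 := (hmem χ).1 hχ
  have h2 : (kerPoint hE χ).1.comap f = (kerPoint hE' ⟨_, h1⟩).1 := by
    simp [kerPoint, LinearMap.ker_comp]
  have h3 : Module.finrank k ((kerPoint hE χ).1.comap f) = m' := by
    rw [h2]; exact (kerPoint hE' ⟨_, h1⟩).2
  have h4 : P χ = ⟨_, h1⟩ := dif_pos h1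
  simp only [Function.comp, h4]
  exact (Subtype.ext h2.symm : _ = (⟨_, h3⟩ : Gr k E' m')).trans (hGpos _ h3).symm

end Hyperplanes

/-! ### Powers of the arrow ideal and path length -/

section PathAlgebraPowers

variable (k : Type*) [Field k] {Q₀ : Type*} [Quiver Q₀]

/-- The coefficient of a path. -/
noncomputable def coeff (p : AllPaths Q₀) : PathAlgebra k Q₀ →ₗ[k] k :=
  (Finsupp.lapply p : (AllPaths Q₀ →₀ k) →ₗ[k] k)

theorem coeff_ofPath [DecidableEq (AllPaths Q₀)] (p q : AllPaths Q₀) :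
    coeff k p (ofPath k q) = if q = p then 1 else 0 :=
  Finsupp.single_apply

variable (Q₀) in
/-- The span of the paths of length at least `m`. -/
noncomputable def longPaths (m : ℕ) : Submodule k (PathAlgebra k Q₀) :=
  Submodule.span k (ofPath k '' {p | m ≤ p.2.2.length})

variable {k}

theorem ofPath_mem_longPaths {p : AllPaths Q₀} {m : ℕ} (h : m ≤ p.2.2.length) :
    ofPath k p ∈ longPaths k Q₀ m :=
  Submodule.subset_span ⟨p, h, rfl⟩

theorem mem_longPaths_zero (x : PathAlgebra k Q₀) : x ∈ longPaths k Q₀ 0 :=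
  pathAlgebra_induction k x (zero_mem _) (fun _ _ => add_mem)
    fun c _ => Submodule.smul_mem _ c (ofPath_mem_longPaths (Nat.zero_le _))

theorem coeff_eq_zero_of_mem_longPaths {m : ℕ} {x : PathAlgebra k Q₀} (hx : x ∈ longPaths k Q₀ m)
    {p : AllPaths Q₀} (hp : p.2.2.length < m) : coeff k p x = 0 := by
  classical
  have : longPaths k Q₀ m ≤ LinearMap.ker (coeff k p) := by
    refine Submodule.span_le.2 ?_
    rintro _ ⟨q, hq, rfl⟩
    have : q ≠ p := by
      rintro rfl
      exact absurd (Set.mem_ofPred_eq ▸ hq) (by simpa using hp)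
    simp [coeff_ofPath, this]
  exact this hx

variable [Fintype Q₀]

omit [Fintype Q₀] in
theorem ofPath_mul_ofPath (p q : AllPaths Q₀) : ofPath k p * ofPath k q = pathMul k p q :=
  mulHom_ofPath k p q

theorem mul_mem_longPaths {a b : ℕ} {x y : PathAlgebra k Q₀} (hx : x ∈ longPaths k Q₀ a)
    (hy : y ∈ longPaths k Q₀ b) : x * y ∈ longPaths k Q₀ (a + b) := by
  have h : longPaths k Q₀ a * longPaths k Q₀ b ≤ longPaths k Q₀ (a + b) := by
    rw [longPaths, longPaths, Submodule.span_mul_span, Submodule.span_le]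
    rintro _ ⟨_, ⟨⟨s, t, p⟩, hp, rfl⟩, _, ⟨⟨s', t', q⟩, hq, rfl⟩, rfl⟩
    simp only [ofPath_mul_ofPath]
    by_cases h : t = s'
    · subst h
      rw [pathMul_comp]
      refine ofPath_mem_longPaths ?_
      rw [Quiver.Path.length_comp]
      exact add_le_add hp hq
    · rw [pathMul_of_ne k (by exact h)]
      exact zero_mem _
  exact h (Submodule.mul_mem_mul hx hy)

/-- The paths of positive length span a two-sided ideal that contains the arrows. -/
theorem arrowIdeal_le_longPaths {x : PathAlgebra k Q₀} (hx : x ∈ arrowIdeal k Q₀) :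
    x ∈ longPaths k Q₀ 1 := by
  let T : TwoSidedIdeal (PathAlgebra k Q₀) := .mk' (longPaths k Q₀ 1) (zero_mem _) add_mem neg_mem
    (fun h => by simpa using mul_mem_longPaths (mem_longPaths_zero _) h)
    (fun h => by simpa using mul_mem_longPaths h (mem_longPaths_zero _))
  have hT : TwoSidedIdeal.span (Set.range (arrow k (Q₀ := Q₀))) ≤ T := by
    refine TwoSidedIdeal.span_le.2 ?_
    rintro _ ⟨e, rfl⟩
    exact (TwoSidedIdeal.mem_mk' _ _ _ _ _ _ _).2 (ofPath_mem_longPaths le_rfl)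
  exact (TwoSidedIdeal.mem_mk' _ _ _ _ _ _ _).1 (hT (TwoSidedIdeal.mem_asIdeal.1 hx))

theorem arrow_mem_arrowIdeal (e : Quiver.Total Q₀) : arrow k e ∈ arrowIdeal k Q₀ :=
  TwoSidedIdeal.mem_asIdeal.2 (TwoSidedIdeal.subset_span ⟨e, rfl⟩)

/-- With `ofPath_mem_pow`, this identifies `J ^ m` with the span of the paths of length at least
`m`. This inclusion yields independence of short paths modulo `J ^ m`, the other one yields
spanning. -/
theorem longPaths_of_mem_pow {m : ℕ} {x : PathAlgebra k Q₀} (hx : x ∈ arrowIdeal k Q₀ ^ m) :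
    x ∈ longPaths k Q₀ m := by
  induction m generalizing x with
  | zero => exact mem_longPaths_zero x
  | succ m ih =>
    rw [Submodule.pow_succ] at hx
    refine Submodule.mul_induction_on hx (fun a ha b hb => ?_) fun _ _ => add_mem
    exact mul_mem_longPaths (ih ha) (arrowIdeal_le_longPaths hb)

theorem ofPath_mem_pow {m : ℕ} {a b : Q₀} (p : Quiver.Path a b) (h : m ≤ p.length) :
    ofPath k ⟨a, b, p⟩ ∈ arrowIdeal k Q₀ ^ m := by
  induction m generalizing b with
  | zero => rw [Submodule.pow_zero, Ideal.one_eq_top]; trivial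
  | succ m ih =>
    cases p with
    | nil => simp at h
    | @cons c _ q e =>
      have : ofPath k (⟨a, b, q.cons e⟩ : AllPaths Q₀) = ofPath k ⟨a, c, q⟩ * arrow k ⟨c, b, e⟩ := by
        rw [arrow, ofPath_mul_ofPath, pathMul_comp]
        rfl
      rw [this, Submodule.pow_succ]
      exact Ideal.mul_mem_mul (ih q (by simpa using h)) (arrow_mem_arrowIdeal _)

omit [Fintype Q₀] in
theorem finite_paths_length [Finite Q₀] [Finite (Quiver.Total Q₀)] (m : ℕ) :
    {p : AllPaths Q₀ | p.2.2.length = m}.Finite := by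
  induction m with
  | zero =>
    refine (Set.finite_range fun a : Q₀ => (⟨a, a, .nil⟩ : AllPaths Q₀)).subset ?_
    rintro ⟨a, b, p⟩ hp
    cases p with
    | nil => exact ⟨a, rfl⟩
    | cons q e => simp at hp
  | succ m ih =>
    have hfin : ∀ a : Q₀, Finite (Σ b, a ⟶ b) := fun a =>
      Finite.of_injective (β := Quiver.Total Q₀) (fun e => ⟨a, e.1, e.2⟩) (by
        rintro ⟨b, e⟩ ⟨b', e'⟩ h
        simpa using h)
    refine (ih.biUnion fun p _ => Set.finite_range fun e : Σ b, p.2.1 ⟶ b =>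
      (⟨p.1, e.1, p.2.2.cons e.2⟩ : AllPaths Q₀)).subset ?_
    rintro ⟨a, b, p⟩ hp
    cases p with
    | nil => simp at hp
    | @cons c b q e =>
      refine Set.mem_biUnion (x := (⟨a, c, q⟩ : AllPaths Q₀)) ?_ ⟨⟨b, e⟩, rfl⟩
      simpa using hp

theorem finite_quotient [Finite (Quiver.Total Q₀)] (I : Ideal (PathAlgebra k Q₀)) [I.IsTwoSided]
    {l : ℕ} (hl : arrowIdeal k Q₀ ^ l ≤ I) : Module.Finite k (PathAlgebra k Q₀ ⧸ I) := by
  have hfin : {p : AllPaths Q₀ | p.2.2.length < l}.Finite := by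
    refine ((Set.finite_lt_nat l).biUnion fun m _ => finite_paths_length (Q₀ := Q₀) m).subset ?_
    intro p hp
    exact Set.mem_biUnion (x := p.2.2.length) hp rfl
  refine ⟨?_⟩
  have htop : (⊤ : Submodule k (PathAlgebra k Q₀ ⧸ I)) = Submodule.span k
      ((fun p => Ideal.Quotient.mkₐ k I (ofPath k p)) '' {p | p.2.2.length < l}) := by
    refine (eq_top_iff.2 fun x _ => ?_).symm
    obtain ⟨x, rfl⟩ := Ideal.Quotient.mk_surjective x
    change Ideal.Quotient.mkₐ k I x ∈ _
    refine pathAlgebra_induction k (P := fun x => Ideal.Quotient.mkₐ k I x ∈ _) x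
      (by simp) (fun _ _ h h' => by rw [map_add]; exact add_mem h h') fun c p => ?_
    rw [map_smul]
    refine Submodule.smul_mem _ _ ?_
    by_cases hp : p.2.2.length < l
    · exact Submodule.subset_span ⟨p, hp, rfl⟩
    · have : Ideal.Quotient.mkₐ k I (ofPath k p) = 0 :=
        Ideal.Quotient.eq_zero_iff_mem.2 (hl (ofPath_mem_pow p.2.2 (not_lt.1 hp)))
      rw [this]
      exact zero_mem _
  rw [htop]
  exact Submodule.fg_span (hfin.image _)

end PathAlgebraPowers

/-! ### The basis and multiplication table of `T₂Q` -/

section TruncatedBasis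

variable (k : Type*) [Field k] {Q₀ : Type*} [Quiver Q₀] [Fintype Q₀] {n₀ n₁ : ℕ}

/-- The vertices and the arrows in `T₂Q`. -/
noncomputable def fullGen (v : Fin (n₀ + 1) ≃ Q₀) (α : Fin n₁ ≃ Quiver.Total Q₀) :
    Fin (n₀ + 1) ⊕ Fin n₁ → T2 k Q₀ :=
  Sum.elim (fun i => Ideal.Quotient.mk _ (vertex k (v i)))
    (fun j => Ideal.Quotient.mk _ (arrow k (α j)))

/-- The paths of length at most one. -/
def shortPath (v : Fin (n₀ + 1) ≃ Q₀) (α : Fin n₁ ≃ Quiver.Total Q₀) :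
    Fin (n₀ + 1) ⊕ Fin n₁ → AllPaths Q₀ :=
  Sum.elim (fun i => ⟨v i, v i, .nil⟩) (fun j => ⟨(α j).left, (α j).right, (α j).hom.toPath⟩)

omit [Fintype Q₀] in
theorem shortPath_injective (v : Fin (n₀ + 1) ≃ Q₀) (α : Fin n₁ ≃ Quiver.Total Q₀) :
    Function.Injective (shortPath v α) := by
  have hl : ∀ i, (shortPath v α (.inl i)).2.2.length = 0 := fun i => rfl
  have hr : ∀ j, (shortPath v α (.inr j)).2.2.length = 1 := fun i => rfl
  rintro (i | i) (j | j) h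
  · exact congrArg _ (v.injective (congrArg Sigma.fst h))
  · have := hl i; rw [h, hr] at this; omega
  · have := hr i; rw [h, hl] at this; omega
  · refine congrArg _ (α.injective ?_)
    have : ∀ e e' : Quiver.Total Q₀,
        (⟨e.left, e.right, e.hom.toPath⟩ : AllPaths Q₀) = ⟨e'.left, e'.right, e'.hom.toPath⟩ →
          e = e' := by
      rintro ⟨a, b, e⟩ ⟨a', b', e'⟩ h
      simp only [Sigma.mk.injEq] at h
      obtain ⟨rfl, h⟩ := h
      simp only [heq_eq_eq, Sigma.mk.injEq] at h
      obtain ⟨rfl, h⟩ := h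
      simp only [heq_eq_eq, Quiver.Hom.toPath, Quiver.Path.cons.injEq, true_and] at h
      rw [h]
    exact this _ _ h

theorem fullGen_eq (v : Fin (n₀ + 1) ≃ Q₀) (α : Fin n₁ ≃ Quiver.Total Q₀)
    (x : Fin (n₀ + 1) ⊕ Fin n₁) :
    fullGen k v α x = Ideal.Quotient.mkₐ k (arrowIdeal k Q₀ ^ 2) (ofPath k (shortPath v α x)) := by
  cases x <;> rfl

/-- A relation lifts to a combination of paths of length at most one lying in `J ^ 2`, whose
elements have zero coefficient at every such path. -/
theorem linearIndependent_fullGen (v : Fin (n₀ + 1) ≃ Q₀) (α : Fin n₁ ≃ Quiver.Total Q₀) :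
    LinearIndependent k (fullGen k v α) := by
  classical
  rw [Fintype.linearIndependent_iff]
  intro c hc y
  have h1 : Ideal.Quotient.mkₐ k (arrowIdeal k Q₀ ^ 2)
      (∑ x, c x • ofPath k (shortPath v α x)) = 0 := by
    rw [← hc, map_sum]
    exact Finset.sum_congr rfl fun x _ => by rw [map_smul, fullGen_eq]
  have h2 := longPaths_of_mem_pow (Ideal.Quotient.eq_zero_iff_mem.1 h1)
  have hlt : (shortPath v α y).2.2.length < 2 := by
    cases y <;> simp [shortPath]
  have h3 := coeff_eq_zero_of_mem_longPaths h2 hlt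
  simpa only [map_sum, map_smul, coeff_ofPath, (shortPath_injective v α).eq_iff, smul_eq_mul,
    mul_ite, mul_one, mul_zero, Finset.sum_ite_eq', Finset.mem_univ, if_true] using h3

theorem span_fullGen (v : Fin (n₀ + 1) ≃ Q₀) (α : Fin n₁ ≃ Quiver.Total Q₀) :
    ⊤ ≤ Submodule.span k (Set.range (fullGen k v α)) := by
  intro x _
  obtain ⟨x, rfl⟩ := Ideal.Quotient.mk_surjective x
  change Ideal.Quotient.mkₐ k (arrowIdeal k Q₀ ^ 2) x ∈ _
  refine pathAlgebra_induction k (P := fun x => Ideal.Quotient.mkₐ k (arrowIdeal k Q₀ ^ 2) x ∈ _) x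
    (by simp) (fun _ _ h h' => by rw [map_add]; exact add_mem h h') fun c p => ?_
  rw [map_smul]
  refine Submodule.smul_mem _ _ ?_
  by_cases hp : 2 ≤ p.2.2.length
  · have : Ideal.Quotient.mkₐ k (arrowIdeal k Q₀ ^ 2) (ofPath k p) = 0 :=
      Ideal.Quotient.eq_zero_iff_mem.2 (ofPath_mem_pow p.2.2 hp)
    rw [this]
    exact zero_mem _
  · refine Submodule.subset_span ?_
    obtain ⟨a, b, p⟩ := p
    match p, hp with
    | .nil, _ =>
      obtain ⟨i, rfl⟩ := v.surjective a
      exact ⟨.inl i, rfl⟩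
    | .cons .nil e, _ =>
      obtain ⟨j, hj⟩ := α.surjective ⟨a, b, e⟩
      exact ⟨.inr j, congrArg (fun e : Quiver.Total Q₀ => Ideal.Quotient.mk _ (arrow k e)) hj⟩
    | .cons (.cons q e) e', hp => simp at hp

/-- The basis of `T₂Q` consisting of the vertices and the arrows. -/
noncomputable def fullBasis (v : Fin (n₀ + 1) ≃ Q₀) (α : Fin n₁ ≃ Quiver.Total Q₀) :
    Module.Basis (Fin (n₀ + 1) ⊕ Fin n₁) k (T2 k Q₀) :=
  .mk (linearIndependent_fullGen k v α) (span_fullGen k v α)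

theorem fullBasis_apply (v : Fin (n₀ + 1) ≃ Q₀) (α : Fin n₁ ≃ Quiver.Total Q₀) (x) :
    fullBasis k v α x = fullGen k v α x := by
  simp [fullBasis]

variable (v : Fin (n₀ + 1) ≃ Q₀) (α : Fin n₁ ≃ Quiver.Total Q₀)

theorem one_eq_sum_fullGen : (1 : T2 k Q₀) = ∑ i, fullGen k v α (.inl i) := by
  have : (1 : T2 k Q₀) = Ideal.Quotient.mk (arrowIdeal k Q₀ ^ 2) 1 := rfl
  rw [this, one_def, map_sum, ← v.sum_comp]
  rfl

omit [Fintype Q₀] in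
theorem pathMul_nil_left {a b c : Q₀} (p : Quiver.Path a b) (h : c = a) :
    pathMul k ⟨c, c, .nil⟩ ⟨a, b, p⟩ = ofPath k ⟨a, b, p⟩ := by
  subst h
  rw [pathMul_comp, Quiver.Path.nil_comp]

omit [Fintype Q₀] in
theorem pathMul_nil_right {a b c : Q₀} (p : Quiver.Path a b) (h : c = b) :
    pathMul k ⟨a, b, p⟩ ⟨c, c, .nil⟩ = ofPath k ⟨a, b, p⟩ := by
  subst h
  rw [pathMul_comp, Quiver.Path.comp_nil]

theorem fullGen_inl_mul_inl (i j : Fin (n₀ + 1)) :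
    fullGen k v α (.inl i) * fullGen k v α (.inl j) =
      if i = j then fullGen k v α (.inl i) else 0 := by
  rw [fullGen_eq, fullGen_eq, ← map_mul, ofPath_mul_ofPath]
  split_ifs with h
  · subst h
    exact congrArg _ (pathMul_comp k Quiver.Path.nil Quiver.Path.nil)
  · rw [pathMul_of_ne k (by simpa [shortPath] using h), map_zero]

theorem fullGen_inl_mul_inr (i : Fin (n₀ + 1)) (j : Fin n₁) :
    fullGen k v α (.inl i) * fullGen k v α (.inr j) =
      if v.symm (α j).left = i then fullGen k v α (.inr j) else 0 := by
  rw [fullGen_eq, fullGen_eq, ← map_mul, ofPath_mul_ofPath]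
  split_ifs with h
  · subst h
    exact congrArg _ (pathMul_nil_left k _ (v.apply_symm_apply _))
  · rw [pathMul_of_ne k fun h' => h (v.symm_apply_eq.2 h'.symm), map_zero]

theorem fullGen_inr_mul_inl (i : Fin (n₀ + 1)) (j : Fin n₁) :
    fullGen k v α (.inr j) * fullGen k v α (.inl i) =
      if v.symm (α j).right = i then fullGen k v α (.inr j) else 0 := by
  rw [fullGen_eq, fullGen_eq, ← map_mul, ofPath_mul_ofPath]
  split_ifs with h
  · subst h
    exact congrArg _ (pathMul_nil_right k _ (v.apply_symm_apply _))
  · rw [pathMul_of_ne k fun h' => h (v.symm_apply_eq.2 h'), map_zero]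

theorem fullGen_inr_mul_inr (i j : Fin n₁) :
    fullGen k v α (.inr i) * fullGen k v α (.inr j) = 0 := by
  rw [fullGen_eq, fullGen_eq, ← map_mul]
  refine Ideal.Quotient.eq_zero_iff_mem.2 ?_
  rw [show (2 : ℕ) = 1 + 1 from rfl, Submodule.pow_succ, Submodule.pow_one]
  exact Ideal.mul_mem_mul (arrow_mem_arrowIdeal _) (arrow_mem_arrowIdeal _)

end TruncatedBasis

/-! ### The vanishing ideal of the cone -/

section Cone

open MvPolynomial

variable {k : Type*} [Field k] {n₀ n₁ : ℕ}

/-- The coordinates of the difference of the idempotents at `s` and `t`. -/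
def endCoef (R : Type*) [Ring R] (s t : Fin (n₀ + 1)) (i : Fin n₀) : R :=
  (if i.succ = s then 1 else 0) - (if i.succ = t then 1 else 0)

/-- The union over the pairs `(s, t)` of vertices of the linear spaces of those points whose
vertex part is proportional to the difference of the idempotents at `s` and `t`, and whose arrow
part is concentrated on the arrows from `s` to `t`. -/
def OnCone (src tgt : Fin n₁ → Fin (n₀ + 1)) (y : Fin n₀ ⊕ Fin n₁ → k) : Prop :=
  ∃ (s t : Fin (n₀ + 1)) (c : k), (∀ i, y (.inl i) = c * endCoef k s t i) ∧
    ∀ j, ¬ (src j = s ∧ tgt j = t) → y (.inr j) = 0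

/-- The relations between the coordinates of the points of the cone, modulo an ideal. -/
structure ConeRelations (src tgt : Fin n₁ → Fin (n₀ + 1))
    (Y : Ideal (MvPolynomial (Fin n₀ ⊕ Fin n₁) k)) : Prop where
  two : ∀ i j : Fin n₀, i ≠ j →
    X (.inl i) * X (.inl j) * (X (.inl i) + X (.inl j)) ∈ Y
  three : ∀ i j l : Fin n₀, i ≠ j → i ≠ l → j ≠ l →
    X (.inl i) * X (.inl j) * X (.inl l) ∈ Y
  off : ∀ (a : Fin n₁) (i : Fin n₀), i.succ ≠ src a → i.succ ≠ tgt a →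
    X (.inr a) * X (.inl i) ∈ Y
  loop : ∀ (a : Fin n₁) (i : Fin n₀), i.succ = src a → i.succ = tgt a →
    X (.inr a) * X (.inl i) ∈ Y
  edge : ∀ (a : Fin n₁) (i l : Fin n₀), l.succ = src a → i.succ = tgt a → i ≠ l →
    X (.inr a) * (X (.inl i) + X (.inl l)) ∈ Y
  arrows : ∀ a a' : Fin n₁, ¬ (src a' = src a ∧ tgt a' = tgt a) →
    X (.inr a) * X (.inr a') ∈ Y

theorem eval_aeval_eq {σ : Type*} (w : σ → MvPolynomial σ k) (y : σ → k) (f : MvPolynomial σ k) :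
    eval y (aeval w f) = eval (fun x => eval y (w x)) f := by
  have : (eval y).comp (aeval w : MvPolynomial σ k →ₐ[k] MvPolynomial σ k).toRingHom =
      eval (fun x => eval y (w x)) := by
    refine ringHom_ext (fun r => ?_) fun x => ?_
    · simp
    · simp
  exact congrArg (fun g : MvPolynomial σ k →+* k => g f) this

/-- The hypothesis says that `X x` and `w x` agree modulo the ideal quotient `Y : m`; hence so do
`g` and its substitution by `w`. -/
theorem mul_sub_aeval_mem {σ : Type*} {Y : Ideal (MvPolynomial σ k)} {m : MvPolynomial σ k}
    {w : σ → MvPolynomial σ k} (h : ∀ x, m * (X x - w x) ∈ Y) (g : MvPolynomial σ k) :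
    m * (g - aeval w g) ∈ Y := by
  induction g using MvPolynomial.induction_on with
  | C a => simp [MvPolynomial.algebraMap_eq]
  | add p q hp hq =>
    have := add_mem hp hq
    rw [map_add]
    convert this using 1
    ring
  | mul_X p x hp =>
    have := add_mem (Y.mul_mem_right (X x) hp) (Y.mul_mem_left (aeval w p) (h x))
    rw [map_mul, aeval_X]
    convert this using 1
    ring

variable {src tgt : Fin n₁ → Fin (n₀ + 1)} {f : MvPolynomial (Fin n₀ ⊕ Fin n₁) k}

theorem aeval_eq_zero_of_cone [Infinite k] (hf : ∀ y, OnCone src tgt y → eval y f = 0)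
    {w : Fin n₀ ⊕ Fin n₁ → MvPolynomial (Fin n₀ ⊕ Fin n₁) k}
    (hw : ∀ y : Fin n₀ ⊕ Fin n₁ → k, OnCone src tgt fun x => eval y (w x)) : aeval w f = 0 :=
  MvPolynomial.funext fun y => by rw [eval_aeval_eq, hf _ (hw y), map_zero]

variable (k n₁) in
/-- The scalar of a point of the component of `(s, t)` as a linear form. -/
noncomputable def scaleForm (s t : Fin (n₀ + 1)) : MvPolynomial (Fin n₀ ⊕ Fin n₁) k :=
  -- The scalar is the coordinate at `s` when `s` is not the omitted vertex, and otherwise minus the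
  -- coordinate at `t`. For `s = t` its value is harmless, since `endCoef` is then zero.
  Fin.cases (Fin.cases 0 (fun i => - X (.inl i)) t) (fun i => X (.inl i)) s

variable (k src tgt) in
/-- The retraction onto the component of `(s, t)`. -/
noncomputable def retract (s t : Fin (n₀ + 1)) :
    Fin n₀ ⊕ Fin n₁ → MvPolynomial (Fin n₀ ⊕ Fin n₁) k :=
  Sum.elim (fun i => scaleForm k n₁ s t * endCoef _ s t i)
    (fun j => if src j = s ∧ tgt j = t then X (.inr j) else 0)

theorem map_endCoef {R S : Type*} [Ring R] [Ring S] (g : R →+* S) (s t : Fin (n₀ + 1))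
    (i : Fin n₀) : g (endCoef R s t i) = endCoef S s t i := by
  simp only [endCoef, map_sub]
  split_ifs <;> simp

theorem endCoef_left (R : Type*) [Ring R] {i j : Fin n₀} (h : i ≠ j) :
    endCoef R i.succ j.succ i = 1 := by simp [endCoef, h]

theorem endCoef_right (R : Type*) [Ring R] {i j : Fin n₀} (h : i ≠ j) :
    endCoef R i.succ j.succ j = -1 := by simp [endCoef, h.symm]

theorem endCoef_other (R : Type*) [Ring R] {i j l : Fin n₀} (hi : l ≠ i) (hj : l ≠ j) :
    endCoef R i.succ j.succ l = 0 := by simp [endCoef, hi, hj]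

theorem onCone_retract (s t : Fin (n₀ + 1)) (y : Fin n₀ ⊕ Fin n₁ → k) :
    OnCone src tgt fun x => eval y (retract k src tgt s t x) :=
  ⟨s, t, eval y (scaleForm k n₁ s t), fun i => by simp [retract, map_endCoef],
    fun j hj => by simp [retract, hj]⟩

/-- A nonzero arrow coordinate `a` pins down the component `(src a, tgt a)`. Algebraically: modulo
`Y` and after multiplication by this variable, every variable may be replaced by its retraction onto
that component. -/
theorem ConeRelations.arrow_mul_sub {Y : Ideal (MvPolynomial (Fin n₀ ⊕ Fin n₁) k)}
    (hY : ConeRelations src tgt Y) (a : Fin n₁) (x : Fin n₀ ⊕ Fin n₁) :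
    X (.inr a) * (X x - retract k src tgt (src a) (tgt a) x) ∈ Y := by
  rcases x with i | j
  · simp only [retract, Sum.elim_inl, endCoef]
    by_cases hs : i.succ = src a <;> by_cases ht : i.succ = tgt a
    · simpa [hs, ht, ← ht.symm.trans hs] using hY.loop a i hs ht
    · simp [← hs, scaleForm, ht]
    · rw [if_neg hs, if_pos ht, zero_sub, mul_neg, mul_one, sub_neg_eq_add]
      -- If the source is the omitted vertex, the retraction fixes the variable of the target and
      -- nothing is needed; otherwise the `edge` relation applies.
      obtain h0 | ⟨l, hl⟩ := Fin.eq_zero_or_eq_succ (src a)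
      · rw [h0, ← ht]
        simp [scaleForm]
      · rw [hl]
        simp only [scaleForm, Fin.cases_succ]
        exact hY.edge a i l hl.symm ht (by rintro rfl; exact hs hl.symm)
    · simpa [hs, ht] using hY.off a i hs ht
  · simp only [retract, Sum.elim_inr]
    split_ifs with h
    · simp
    · simpa using hY.arrows a j h

variable (k n₀ n₁) in
/-- The ideal generated by the arrow variables. -/
noncomputable def arrowVars : Ideal (MvPolynomial (Fin n₀ ⊕ Fin n₁) k) :=
  Ideal.span (Set.range fun a : Fin n₁ => X (.inr a))

/-- In `h = ∑ g a * X a`, the term of `a` survives only under the retraction to the component of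
`a`, and there it is congruent to the original term. -/
theorem ConeRelations.sub_sum_retract_mem {Y : Ideal (MvPolynomial (Fin n₀ ⊕ Fin n₁) k)}
    (hY : ConeRelations src tgt Y) {h : MvPolynomial (Fin n₀ ⊕ Fin n₁) k}
    (hh : h ∈ arrowVars k n₀ n₁) :
    h - ∑ p : Fin (n₀ + 1) × Fin (n₀ + 1), aeval (retract k src tgt p.1 p.2) h ∈ Y := by
  obtain ⟨g, rfl⟩ := Ideal.mem_span_range_iff_exists_fun.1 hh
  have : ∑ p : Fin (n₀ + 1) × Fin (n₀ + 1),
      aeval (retract k src tgt p.1 p.2) (∑ a, g a * X (.inr a)) =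
      ∑ a, X (.inr a) * aeval (retract k src tgt (src a) (tgt a)) (g a) := by
    simp only [map_sum]
    rw [Finset.sum_comm]
    refine Finset.sum_congr rfl fun a _ => ?_
    rw [Finset.sum_eq_single (src a, tgt a)]
    · simp [retract, mul_comm]
    · rintro ⟨s, t⟩ - hne
      have : ¬ (src a = s ∧ tgt a = t) := fun h => hne (by rw [h.1, h.2])
      simp [retract, this]
    · simp
  rw [this, ← Finset.sum_sub_distrib]
  refine sum_mem fun a _ => ?_
  have := mul_sub_aeval_mem (hY.arrow_mul_sub a) (g a)
  convert this using 1
  ring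

variable (k n₀ n₁) in
/-- The substitution which kills the arrows. -/
noncomputable def killArrows : Fin n₀ ⊕ Fin n₁ → MvPolynomial (Fin n₀ ⊕ Fin n₁) k :=
  Sum.elim (fun i => X (.inl i)) (fun _ => 0)

theorem eval_killArrows_eq_zero (hf : ∀ y, OnCone src tgt y → eval y f = 0)
    (y : Fin n₀ ⊕ Fin n₁ → k) (hy : ∃ (s t : Fin (n₀ + 1)) (c : k),
      ∀ i, y (.inl i) = c * endCoef k s t i) :
    eval y (aeval (killArrows k n₀ n₁) f) = 0 := by
  obtain ⟨s, t, c, h⟩ := hy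
  rw [eval_aeval_eq]
  exact hf _ ⟨s, t, c, fun i => by simpa [killArrows] using h i, fun j _ => by simp [killArrows]⟩

/-- The difference lies in the ideal of the arrow variables, and all its retractions vanish: setting
the arrow coordinates to zero preserves the cone, so both terms vanish on it. -/
theorem ConeRelations.sub_killArrows_mem [Infinite k]
    {Y : Ideal (MvPolynomial (Fin n₀ ⊕ Fin n₁) k)}
    (hY : ConeRelations src tgt Y) (hf : ∀ y, OnCone src tgt y → eval y f = 0) :
    f - aeval (killArrows k n₀ n₁) f ∈ Y := by
  have h1 : f - aeval (killArrows k n₀ n₁) f ∈ arrowVars k n₀ n₁ := by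
    have := mul_sub_aeval_mem (Y := arrowVars k n₀ n₁) (m := 1) (w := killArrows k n₀ n₁)
      (fun x => ?_) f
    · simpa using this
    · rcases x with i | a
      · simp [killArrows]
      · have : X (.inr a) ∈ arrowVars k n₀ n₁ := Ideal.subset_span ⟨a, rfl⟩
        simpa [killArrows] using this
  have h2 := hY.sub_sum_retract_mem h1
  rw [Finset.sum_eq_zero, sub_zero] at h2
  · exact h2
  · rintro ⟨s, t⟩ -
    rw [map_sub, aeval_eq_zero_of_cone hf (onCone_retract s t),
      aeval_eq_zero_of_cone (fun y hy => ?_) (onCone_retract s t), sub_zero]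
    obtain ⟨s, t, c, h, -⟩ := hy
    exact eval_killArrows_eq_zero hf y ⟨s, t, c, h⟩

/-- A polynomial that vanishes at all multiples of differences of two idempotents lies in the
ideal generated by the products of two vertex variables. -/
theorem mem_span_products [Infinite k] {f : MvPolynomial (Fin n₀ ⊕ Fin n₁) k}
    (hf : ∀ y : Fin n₀ ⊕ Fin n₁ → k, (∃ (s t : Fin (n₀ + 1)) (c : k),
      ∀ i, y (.inl i) = c * endCoef k s t i) → eval y f = 0) :
    f ∈ Ideal.span (Set.range fun p : {p : Fin n₀ × Fin n₀ // p.1 < p.2} =>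
      (X (.inl p.1.1) * X (.inl p.1.2) : MvPolynomial (Fin n₀ ⊕ Fin n₁) k)) := by
  set Z := Ideal.span (Set.range fun p : {p : Fin n₀ × Fin n₀ // p.1 < p.2} =>
      (X (.inl p.1.1) * X (.inl p.1.2) : MvPolynomial (Fin n₀ ⊕ Fin n₁) k)) with hZ
  have hmem : ∀ i j : Fin n₀, i ≠ j → X (.inl i) * X (.inl j) ∈ Z := by
    intro i j h
    rcases lt_or_gt_of_ne h with h | h
    · exact Ideal.subset_span ⟨⟨(i, j), h⟩, rfl⟩
    · rw [mul_comm]; exact Ideal.subset_span ⟨⟨(j, i), h⟩, rfl⟩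
  -- The substitutions keeping no vertex variable, or a single one, take values in the locus where
  -- `f` vanishes (for `w i`, the pair `(i.succ, 0)`). They remove successively the part without
  -- vertex variables and the part with exactly one.
  let w₀ : Fin n₀ ⊕ Fin n₁ → MvPolynomial (Fin n₀ ⊕ Fin n₁) k :=
    Sum.elim (fun _ => 0) (fun a => X (.inr a))
  let w : Fin n₀ → Fin n₀ ⊕ Fin n₁ → MvPolynomial (Fin n₀ ⊕ Fin n₁) k := fun i =>
    Sum.elim (fun l => if l = i then X (.inl i) else 0) (fun a => X (.inr a))
  have hw₀ : aeval w₀ f = 0 := MvPolynomial.funext fun y => by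
    rw [eval_aeval_eq, map_zero]
    exact hf _ ⟨0, 0, 0, fun i => by simp [w₀]⟩
  have hw : ∀ i, aeval (w i) f = 0 := fun i => MvPolynomial.funext fun y => by
    rw [eval_aeval_eq, map_zero]
    refine hf _ ⟨i.succ, 0, y (.inl i), fun l => ?_⟩
    by_cases h : l = i <;> simp [w, endCoef, h]
  have h1 : f ∈ Ideal.span (Set.range fun i : Fin n₀ =>
      (X (.inl i) : MvPolynomial (Fin n₀ ⊕ Fin n₁) k)) := by
    have := mul_sub_aeval_mem (m := 1) (w := w₀) (Y := Ideal.span (Set.range fun i : Fin n₀ =>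
      (X (.inl i) : MvPolynomial (Fin n₀ ⊕ Fin n₁) k))) (fun x => ?_) f
    · rwa [hw₀, sub_zero, one_mul] at this
    · rcases x with i | a
      · have : X (.inl i) ∈ Ideal.span (Set.range fun i : Fin n₀ =>
            (X (.inl i) : MvPolynomial (Fin n₀ ⊕ Fin n₁) k)) := Ideal.subset_span ⟨i, rfl⟩
        simpa [w₀] using this
      · simp [w₀]
  obtain ⟨g, hg⟩ := Ideal.mem_span_range_iff_exists_fun.1 h1
  have h2 : ∀ i, X (.inl i) * aeval (w i) (g i) = 0 := by
    intro i
    rw [← hw i, ← hg, map_sum, Finset.sum_eq_single i]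
    · simp [w, mul_comm]
    · intro l _ hl
      simp [w, hl]
    · simp
  have h3 : ∀ i, g i * X (.inl i) = X (.inl i) * (g i - aeval (w i) (g i)) := by
    intro i
    rw [mul_sub, h2, sub_zero, mul_comm]
  rw [← hg]
  refine sum_mem fun i _ => ?_
  rw [h3]
  refine mul_sub_aeval_mem (fun x => ?_) _
  rcases x with l | a
  · by_cases h : l = i
    · simp [w, h]
    · simpa [w, h] using hmem i l (Ne.symm h)
  · simp [w]

/-- Write `f` as a combination of products `X i * X j` with coefficients `g p`. Restriction to the
line of the pair `p` kills all other products, so `g p` vanishes there; multiplied by `X i * X j`,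
it is congruent to this restriction by `two` and `three`. -/
theorem ConeRelations.mem_of_vertices [Infinite k] {Y : Ideal (MvPolynomial (Fin n₀ ⊕ Fin n₁) k)}
    (hY : ConeRelations src tgt Y)
    (hf : ∀ y : Fin n₀ ⊕ Fin n₁ → k, (∃ (s t : Fin (n₀ + 1)) (c : k),
      ∀ i, y (.inl i) = c * endCoef k s t i) → eval y f = 0) : f ∈ Y := by
  obtain ⟨g, hg⟩ := Ideal.mem_span_range_iff_exists_fun.1 (mem_span_products hf)
  let w : {p : Fin n₀ × Fin n₀ // p.1 < p.2} → Fin n₀ ⊕ Fin n₁ →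
      MvPolynomial (Fin n₀ ⊕ Fin n₁) k := fun p =>
    Sum.elim (fun l => X (.inl p.1.1) * endCoef _ p.1.1.succ p.1.2.succ l) (fun a => X (.inr a))
  have hw : ∀ p, aeval (w p) f = 0 := fun p => MvPolynomial.funext fun y => by
    rw [eval_aeval_eq, map_zero]
    exact hf _ ⟨p.1.1.succ, p.1.2.succ, y (.inl p.1.1), fun l => by simp [w, map_endCoef]⟩
  have hzero : ∀ p, aeval (w p) (g p) = 0 := by
    intro p
    have h1 := hw p
    rw [← hg, map_sum, Finset.sum_eq_single p] at h1
    · have e1 : w p (.inl p.1.1) = X (.inl p.1.1) := by simp only [w, Sum.elim_inl, endCoef_left _ p.2.ne, mul_one]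
      have e2 : w p (.inl p.1.2) = - X (.inl p.1.1) := by
        simp only [w, Sum.elim_inl, endCoef_right _ p.2.ne, mul_neg, mul_one]
      rw [map_mul, map_mul, aeval_X, aeval_X, e1, e2] at h1
      refine (mul_eq_zero.1 h1).resolve_right (mul_ne_zero (X_ne_zero _) ?_)
      exact neg_ne_zero.2 (X_ne_zero _)
    · rintro q - hq
      -- Two ordered pairs with the same entries coincide, so a product other than that of `p` has
      -- an index outside `p`, where `w p` is zero.
      have : endCoef (MvPolynomial (Fin n₀ ⊕ Fin n₁) k) p.1.1.succ p.1.2.succ q.1.1 = 0 ∨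
          endCoef (MvPolynomial (Fin n₀ ⊕ Fin n₁) k) p.1.1.succ p.1.2.succ q.1.2 = 0 := by
        obtain ⟨⟨i, j⟩, hp⟩ := p
        obtain ⟨⟨i', j'⟩, hq'⟩ := q
        simp only [ne_eq, Subtype.mk.injEq, Prod.mk.injEq, not_and] at hq hp hq'
        by_contra! h
        have ha : i' = i ∨ i' = j := by
          by_contra! h'; exact h.1 (endCoef_other _ h'.1 h'.2)
        have hb : j' = i ∨ j' = j := by
          by_contra! h'; exact h.2 (endCoef_other _ h'.1 h'.2)
        rcases ha with rfl | rfl <;> rcases hb with rfl | rfl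
        · exact lt_irrefl _ hq'
        · exact hq rfl rfl
        · exact lt_asymm hp hq'
        · exact lt_irrefl _ hq'
      rw [map_mul, map_mul, aeval_X, aeval_X]
      simp only [w, Sum.elim_inl]
      rcases this with h | h <;> rw [h] <;> ring
    · exact fun h => absurd (Finset.mem_univ _) h
  rw [← hg]
  refine sum_mem fun p _ => ?_
  have h1 : g p * (X (.inl p.1.1) * X (.inl p.1.2)) =
      (X (.inl p.1.1) * X (.inl p.1.2)) * (g p - aeval (w p) (g p)) := by
    rw [hzero, sub_zero, mul_comm]
  rw [h1]
  refine mul_sub_aeval_mem (fun x => ?_) _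
  rcases x with l | a
  · simp only [w, Sum.elim_inl]
    by_cases hi : l = p.1.1
    · rw [hi, endCoef_left _ p.2.ne, mul_one, sub_self, mul_zero]
      exact zero_mem _
    · by_cases hj : l = p.1.2
      · rw [hj, endCoef_right _ p.2.ne, mul_neg, mul_one, sub_neg_eq_add, add_comm]
        exact hY.two p.1.1 p.1.2 p.2.ne
      · rw [endCoef_other _ hi hj, mul_zero, sub_zero]
        exact hY.three _ _ _ p.2.ne (Ne.symm hi) (Ne.symm hj)
  · simp only [w, Sum.elim_inr, sub_self, mul_zero]
    exact zero_mem _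

/-- The polynomials that vanish on the cone belong to every ideal that contains the relations. -/
theorem ConeRelations.mem_of_cone [Infinite k] {Y : Ideal (MvPolynomial (Fin n₀ ⊕ Fin n₁) k)}
    (hY : ConeRelations src tgt Y) (hf : ∀ y, OnCone src tgt y → eval y f = 0) : f ∈ Y := by
  have h1 := hY.sub_killArrows_mem hf
  have h2 : aeval (killArrows k n₀ n₁) f ∈ Y :=
    hY.mem_of_vertices fun y hy => eval_killArrows_eq_zero hf y hy
  simpa using add_mem h1 h2

end Cone

/-! ### Points satisfying the relations are the points of the cone -/

section ConePoints

open MvPolynomial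

variable {k : Type*} [Field k] {n₀ n₁ : ℕ} {src tgt : Fin n₁ → Fin (n₀ + 1)}
  {y : Fin n₀ ⊕ Fin n₁ → k}

theorem ConeRelations.mono {Y Y' : Ideal (MvPolynomial (Fin n₀ ⊕ Fin n₁) k)}
    (h : ConeRelations src tgt Y) (hle : Y ≤ Y') : ConeRelations src tgt Y' where
  two i j hij := hle (h.two i j hij)
  three i j l h1 h2 h3 := hle (h.three i j l h1 h2 h3)
  off a i h1 h2 := hle (h.off a i h1 h2)
  loop a i h1 h2 := hle (h.loop a i h1 h2)
  edge a i l h1 h2 h3 := hle (h.edge a i l h1 h2 h3)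
  arrows a a' h1 := hle (h.arrows a a' h1)

theorem OnCone.coneRelations (h : OnCone src tgt y) :
    ConeRelations src tgt (RingHom.ker (eval y)) := by
  obtain ⟨s, t, c, h0, h1⟩ := h
  refine ⟨fun i j hij => ?_, fun i j l h1 h2 h3 => ?_, fun a i hs ht => ?_, fun a i hs ht => ?_,
    fun a i l hs ht hil => ?_, fun a a' haa => ?_⟩ <;>
    simp only [RingHom.mem_ker, map_mul, map_add, eval_X, h0]
  · have : endCoef k s t i * endCoef k s t j * (endCoef k s t i + endCoef k s t j) = 0 := by
      have := (Fin.succ_injective n₀).ne hij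
      simp only [endCoef]
      split_ifs <;> first | (exfalso; grind) | ring
    linear_combination c ^ 3 * this
  · have : endCoef k s t i * endCoef k s t j * endCoef k s t l = 0 := by
      have h1 := (Fin.succ_injective n₀).ne h1
      have h2 := (Fin.succ_injective n₀).ne h2
      have h3 := (Fin.succ_injective n₀).ne h3
      simp only [endCoef]
      split_ifs <;> first | (exfalso; grind) | ring
    linear_combination c ^ 3 * this
  · by_cases h : src a = s ∧ tgt a = t
    · rw [h.1] at hs
      rw [h.2] at ht
      simp [endCoef, hs, ht]
    · simp [h1 a h]
  · by_cases h : src a = s ∧ tgt a = t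
    · rw [h.1] at hs
      rw [h.2] at ht
      simp [endCoef, ← hs, ← ht]
    · simp [h1 a h]
  · by_cases h : src a = s ∧ tgt a = t
    · rw [← h.1, ← h.2, ← hs, ← ht]
      simp [endCoef_left k hil.symm, endCoef_right k hil.symm]
    · simp [h1 a h]
  · by_cases h : src a = s ∧ tgt a = t
    · rw [h.1, h.2] at haa
      simp [h1 a' haa]
    · simp [h1 a h]

/-- A nonzero arrow coordinate determines `(s, t)` as its endpoints. If there is none, `three`
leaves at most two nonzero vertex coordinates, which are opposite by `two`; a single one belongs to
a pair with the omitted vertex. -/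
theorem ConeRelations.onCone (h : ConeRelations src tgt (RingHom.ker (eval y))) :
    OnCone src tgt y := by
  obtain ⟨h2, h3, hoff, hloop, hedge, harr⟩ := h
  simp only [RingHom.mem_ker, map_mul, map_add, eval_X, mul_eq_zero] at h2 h3 hoff hloop hedge harr
  by_cases ha : ∃ a, y (.inr a) ≠ 0
  · obtain ⟨a, ha⟩ := ha
    have hoff' : ∀ i, i.succ ≠ src a → i.succ ≠ tgt a → y (.inl i) = 0 := fun i hs ht =>
      (hoff a i hs ht).resolve_left ha
    have harr' : ∀ a', ¬ (src a' = src a ∧ tgt a' = tgt a) → y (.inr a') = 0 := fun a' h =>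
      (harr a a' h).resolve_left ha
    suffices ∃ c, ∀ i, y (.inl i) = c * endCoef k (src a) (tgt a) i from
      ⟨src a, tgt a, this.choose, this.choose_spec, harr'⟩
    by_cases hst : src a = tgt a
    · refine ⟨0, fun i => ?_⟩
      rw [zero_mul]
      by_cases hi : i.succ = src a
      · exact (hloop a i hi (hi.trans hst)).resolve_left ha
      · exact hoff' i hi (by rwa [← hst])
    · obtain hs | ⟨l, hs⟩ := Fin.eq_zero_or_eq_succ (src a)
      · obtain ht | ⟨l, ht⟩ := Fin.eq_zero_or_eq_succ (tgt a)
        · exact absurd (hs.trans ht.symm) hst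
        · refine ⟨- y (.inl l), fun i => ?_⟩
          by_cases hi : i = l
          · simp [endCoef, hs, ht, hi]
          · rw [hoff' i (by simp [hs]) (by simpa [ht] using hi)]
            simp [endCoef, hs, ht, hi]
      · refine ⟨y (.inl l), fun i => ?_⟩
        by_cases hi : i = l
        · have : l.succ ≠ tgt a := by rwa [← hs]
          simp [endCoef, hs, hi, this]
        · by_cases hit : i.succ = tgt a
          · have := (hedge a i l hs.symm hit hi).resolve_left ha
            rw [hs, ← hit, endCoef_right k (Ne.symm hi)]
            linear_combination this
          · rw [hoff' i (by simpa [hs] using hi) hit]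
            simp [endCoef, hs, hi, hit]
  · push Not at ha
    by_cases hi : ∃ i, y (.inl i) ≠ 0
    · obtain ⟨i, hi⟩ := hi
      by_cases hj : ∃ j, i ≠ j ∧ y (.inl j) ≠ 0
      · obtain ⟨j, hij, hj⟩ := hj
        refine ⟨i.succ, j.succ, y (.inl i), fun l => ?_, fun a _ => ha a⟩
        by_cases hl : l = i
        · rw [hl, endCoef_left k hij, mul_one]
        · by_cases hl' : l = j
          · have := (h2 i j hij).resolve_left (by simp [hi, hj])
            rw [hl', endCoef_right k hij]
            linear_combination this
          · rw [endCoef_other k hl hl', mul_zero]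
            exact (h3 i j l hij (Ne.symm hl) (Ne.symm hl')).resolve_left (by simp [hi, hj])
      · push Not at hj
        refine ⟨i.succ, 0, y (.inl i), fun l => ?_, fun a _ => ha a⟩
        by_cases hl : l = i
        · simp [endCoef, hl]
        · simp [endCoef, hl, hj l (Ne.symm hl)]
    · push Not at hi
      exact ⟨0, 0, 0, by simp [hi], fun a _ => ha a⟩

end ConePoints

/-! ### Removing the signs from the generators of `X` -/

section Twist

open MvPolynomial

variable {k : Type*} [Field k] {Q₀ : Type*} [Quiver Q₀] {n₀ n₁ : ℕ}

variable (k n₀ n₁) in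
/-- The sign of an element of `(Q₀ ∖ {v 0}) ∪ Q₁` in the total order. -/
def sgn : Fin n₀ ⊕ Fin n₁ → k := Sum.elim (fun i => (-1) ^ i.val) (fun j => (-1) ^ (n₀ + j.val))

theorem sgn_mul_sgn (x : Fin n₀ ⊕ Fin n₁) : sgn k n₀ n₁ x * sgn k n₀ n₁ x = 1 := by
  rcases x with i | j <;> simp [sgn, ← mul_pow]

variable (k n₀ n₁) in
/-- The change of the signs of the variables. -/
noncomputable def twist :
    MvPolynomial (Fin n₀ ⊕ Fin n₁) k →ₐ[k] MvPolynomial (Fin n₀ ⊕ Fin n₁) k :=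
  aeval fun x => C (sgn k n₀ n₁ x) * X x

theorem twist_X (x : Fin n₀ ⊕ Fin n₁) : twist k n₀ n₁ (X x) = C (sgn k n₀ n₁ x) * X x := by
  simp [twist]

theorem twist_twist (f : MvPolynomial (Fin n₀ ⊕ Fin n₁) k) :
    twist k n₀ n₁ (twist k n₀ n₁ f) = f := by
  have : (twist k n₀ n₁).comp (twist k n₀ n₁) = AlgHom.id k _ := by
    refine algHom_ext fun x => ?_
    have h : twist k n₀ n₁ (C (sgn k n₀ n₁ x)) = C (sgn k n₀ n₁ x) :=
      (twist k n₀ n₁).commutes _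
    rw [AlgHom.comp_apply, twist_X, map_mul, h, twist_X, ← mul_assoc, ← C_mul, sgn_mul_sgn]
    simp
  exact congrArg (fun g : _ →ₐ[k] _ => g f) this

theorem eval_twist (y : Fin n₀ ⊕ Fin n₁ → k) (f : MvPolynomial (Fin n₀ ⊕ Fin n₁) k) :
    eval y (twist k n₀ n₁ f) = eval (fun x => sgn k n₀ n₁ x * y x) f := by
  rw [twist, eval_aeval_eq]
  simp

variable (v : Fin (n₀ + 1) ≃ Q₀) (α : Fin n₁ ≃ Quiver.Total Q₀)

theorem sign_identity {R : Type*} [CommRing R] {i j : ℕ} (h : i < j) :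
    (-1 : R) ^ (j - i - 1) * (-1) ^ i = - (-1) ^ j := by
  obtain ⟨d, rfl⟩ := Nat.exists_eq_add_of_lt h
  rw [show i + d + 1 - i - 1 = d by omega]
  ring

/-- The sign in the cubic relation only records the positions of the deleted rows; after the sign
change the relation is symmetric in `i` and `j`. -/
theorem twist_two {i j : Fin n₀} (h : i < j) :
    twist k n₀ n₁ (vVar k n₁ i ^ 2 * vVar k n₁ j -
          (-1) ^ (j.val - i.val - 1) * (vVar k n₁ i * vVar k n₁ j ^ 2)) =
      C (sgn k n₀ n₁ (.inl j)) * (X (.inl i) * X (.inl j) * (X (.inl i) + X (.inl j))) := by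
  have h1 := sign_identity (R := MvPolynomial (Fin n₀ ⊕ Fin n₁) k) (Fin.lt_def.1 h)
  have hi : ((-1 : MvPolynomial (Fin n₀ ⊕ Fin n₁) k) ^ i.val) ^ 2 = 1 := by simp [← pow_mul]
  have hj : ((-1 : MvPolynomial (Fin n₀ ⊕ Fin n₁) k) ^ j.val) ^ 2 = 1 := by simp [← pow_mul]
  simp only [vVar, map_sub, map_mul, map_pow, map_neg, map_one, twist_X, sgn, Sum.elim_inl]
  linear_combination (X (.inl i) ^ 2 * (-1) ^ j.val * X (.inl j)) * hi
    - (X (.inl i) * X (.inl j) ^ 2 * ((-1) ^ j.val) ^ 2) * h1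
    + X (.inl i) * X (.inl j) ^ 2 * (-1) ^ j.val * hj

theorem twist_edge (a : Fin n₁) {j l : Fin n₀} (h : j < l) :
    twist k n₀ n₁ ((vVar k n₁ l - (-1) ^ (l.val - j.val - 1) * vVar k n₁ j) * aVar k n₀ a) =
      C (sgn k n₀ n₁ (.inl l)) * C (sgn k n₀ n₁ (.inr a)) *
        (X (.inr a) * (X (.inl l) + X (.inl j))) := by
  have h1 := sign_identity (R := MvPolynomial (Fin n₀ ⊕ Fin n₁) k) (Fin.lt_def.1 h)
  simp only [vVar, aVar, map_sub, map_mul, map_pow, map_neg, map_one, twist_X, sgn, Sum.elim_inl,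
    Sum.elim_inr]
  linear_combination (- X (.inl j) * (-1) ^ (n₀ + a.val) * X (.inr a)) * h1

/-- Since `twist` is an involution and `c` its own inverse, `twist` sends `g` back to `c` times `f`.
-/
theorem mem_comap_twist {Y : Ideal (MvPolynomial (Fin n₀ ⊕ Fin n₁) k)} {c : k} (hc : c * c = 1)
    {f g : MvPolynomial (Fin n₀ ⊕ Fin n₁) k} (h : twist k n₀ n₁ f = C c * g) (hf : f ∈ Y) :
    g ∈ Y.comap (twist k n₀ n₁) := by
  have h1 : g = C c * twist k n₀ n₁ f := by rw [h, ← mul_assoc, ← C_mul, hc]; simp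
  have h2 : twist k n₀ n₁ g = C c * f := by
    have h3 : twist k n₀ n₁ (C c) = C c := (twist k n₀ n₁).commutes _
    rw [h1, map_mul, h3, twist_twist]
  rw [Ideal.mem_comap, h2]
  exact Y.mul_mem_left _ hf

/-- The ideal of the theorem satisfies the relations of the cone, up to signs. -/
theorem coneRelations_comap_twist :
    ConeRelations (fun j => v.symm (α j).left) (fun j => v.symm (α j).right)
      ((X0 k n₀ n₁ ⊔ Xhalf k v α ⊔ X1 k n₀ α).comap (twist k n₀ n₁)) := by
  have hX0 : X0 k n₀ n₁ ≤ X0 k n₀ n₁ ⊔ Xhalf k v α ⊔ X1 k n₀ α := le_sup_left.trans le_sup_left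
  have hXh : Xhalf k v α ≤ X0 k n₀ n₁ ⊔ Xhalf k v α ⊔ X1 k n₀ α := le_sup_right.trans le_sup_left
  have hX1 : X1 k n₀ α ≤ X0 k n₀ n₁ ⊔ Xhalf k v α ⊔ X1 k n₀ α := le_sup_right
  have hsq : ∀ x x' : Fin n₀ ⊕ Fin n₁, (sgn k n₀ n₁ x * sgn k n₀ n₁ x') *
      (sgn k n₀ n₁ x * sgn k n₀ n₁ x') = 1 := fun x x' => by
    rw [mul_mul_mul_comm, sgn_mul_sgn, sgn_mul_sgn, one_mul]
  have htw : ∀ x x' : Fin n₀ ⊕ Fin n₁, twist k n₀ n₁ (X x * X x') =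
      C (sgn k n₀ n₁ x * sgn k n₀ n₁ x') * (X x * X x') := fun x x' => by
    rw [map_mul, twist_X, twist_X, C_mul]; ring
  refine ⟨fun i j hij => ?_, fun i j l h1 h2 h3 => ?_, fun a i hs ht => ?_, fun a i hs ht => ?_,
    fun a i l hs ht hil => ?_, fun a a' haa => ?_⟩
  · wlog h : i < j generalizing i j
    · have := this j i hij.symm (lt_of_le_of_ne (not_lt.1 h) hij.symm)
      convert this using 1
      ring
    exact mem_comap_twist (sgn_mul_sgn _) (twist_two h)
      (hX0 (Ideal.subset_span (.inl ⟨i, j, h, rfl⟩)))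
  · have key : ∀ i j l : Fin n₀, i < j → j < l → X (.inl i) * X (.inl j) * X (.inl l) ∈
        (X0 k n₀ n₁ ⊔ Xhalf k v α ⊔ X1 k n₀ α).comap (twist k n₀ n₁) := by
      intro i j l h h'
      refine mem_comap_twist (c := sgn k n₀ n₁ (.inl i) * sgn k n₀ n₁ (.inl j) *
        sgn k n₀ n₁ (.inl l)) ?_ ?_ (hX0 (Ideal.subset_span (.inr ⟨i, j, l, h, h', rfl⟩)))
      · rw [mul_mul_mul_comm, hsq, sgn_mul_sgn, one_mul]
      · simp only [vVar]
        rw [map_mul, htw, twist_X, C_mul, C_mul, C_mul]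
        ring
    rcases lt_or_gt_of_ne h1 with h1 | h1 <;> rcases lt_or_gt_of_ne h2 with h2 | h2 <;>
      rcases lt_or_gt_of_ne h3 with h3 | h3
    · exact key _ _ _ h1 h3
    · convert key _ _ _ h2 h3 using 1; ring
    · exact absurd (h1.trans h3) (lt_asymm h2)
    · convert key _ _ _ h2 h1 using 1; ring
    · convert key _ _ _ h1 h2 using 1; ring
    · exact absurd (h3.trans h1) (lt_asymm h2)
    · convert key _ _ _ h3 h2 using 1; ring
    · convert key _ _ _ h3 h1 using 1; ring
  · refine mem_comap_twist (hsq _ _) (htw _ _)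
      (hXh (Ideal.subset_span (.inl (.inl ⟨a, i, fun h => hs ?_, fun h => ht ?_, rfl⟩))))
    · rw [← h, v.symm_apply_apply]
    · rw [← h, v.symm_apply_apply]
  · rw [mul_comm]
    refine mem_comap_twist (hsq _ _) (htw _ _)
      (hXh (Ideal.subset_span (.inr ⟨a, i, ?_, ?_, rfl⟩)))
    · rw [hs, v.apply_symm_apply]
    · rw [ht, v.apply_symm_apply]
  · have hs' : (α a).left = v l.succ := by rw [hs, v.apply_symm_apply]
    have ht' : (α a).right = v i.succ := by rw [ht, v.apply_symm_apply]
    rcases lt_or_gt_of_ne hil with h | h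
    · rw [add_comm]
      exact mem_comap_twist (hsq _ _) ((twist_edge a h).trans (by rw [C_mul]))
        (hXh (Ideal.subset_span (.inl (.inr ⟨a, i, l, h, .inr ⟨hs', ht'⟩, rfl⟩))))
    · exact mem_comap_twist (hsq _ _) ((twist_edge a h).trans (by rw [C_mul]))
        (hXh (Ideal.subset_span (.inl (.inr ⟨a, l, i, h, .inl ⟨hs', ht'⟩, rfl⟩))))
  · refine mem_comap_twist (hsq _ _) (htw _ _)
      (hX1 (Ideal.subset_span ⟨a, a', fun h => haa ⟨?_, ?_⟩, rfl⟩))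
    · rw [h.1]
    · rw [h.2]

/-- The converse of `coneRelations_comap_twist`: up to `twist`, `X` is the smallest ideal containing
the cone relations. -/
theorem le_comap_twist {Y : Ideal (MvPolynomial (Fin n₀ ⊕ Fin n₁) k)}
    (hY : ConeRelations (fun j => v.symm (α j).left) (fun j => v.symm (α j).right) Y) :
    X0 k n₀ n₁ ⊔ Xhalf k v α ⊔ X1 k n₀ α ≤ Y.comap (twist k n₀ n₁) := by
  have htw : ∀ x x' : Fin n₀ ⊕ Fin n₁, twist k n₀ n₁ (X x * X x') =
      C (sgn k n₀ n₁ x * sgn k n₀ n₁ x') * (X x * X x') := fun x x' => by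
    rw [map_mul, twist_X, twist_X, C_mul]; ring
  refine sup_le (sup_le ?_ ?_) ?_ <;> refine Ideal.span_le.2 ?_
  · rintro _ (⟨i, j, h, rfl⟩ | ⟨i, j, l, h, h', rfl⟩)
    · rw [SetLike.mem_coe, Ideal.mem_comap, twist_two h]
      exact Y.mul_mem_left _ (hY.two i j h.ne)
    · rw [SetLike.mem_coe, Ideal.mem_comap, vVar, vVar, vVar, map_mul, htw, twist_X,
        mul_mul_mul_comm]
      exact Y.mul_mem_left _ (hY.three i j l h.ne (h.trans h').ne h'.ne)
  · rintro _ ((⟨a, j, hs, ht, rfl⟩ | ⟨a, j, l, h, hst, rfl⟩) | ⟨a, j, hs, ht, rfl⟩)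
    · rw [SetLike.mem_coe, Ideal.mem_comap, vVar, aVar, htw]
      refine Y.mul_mem_left _ (hY.off a j (fun h => hs ?_) fun h => ht ?_)
      · rw [h, v.apply_symm_apply]
      · rw [h, v.apply_symm_apply]
    · rw [SetLike.mem_coe, Ideal.mem_comap, twist_edge a h]
      refine Y.mul_mem_left _ ?_
      rcases hst with ⟨hs, ht⟩ | ⟨hs, ht⟩
      · exact hY.edge a l j (by rw [hs, v.symm_apply_apply]) (by rw [ht, v.symm_apply_apply]) h.ne'
      · rw [add_comm]
        exact hY.edge a j l (by rw [hs, v.symm_apply_apply]) (by rw [ht, v.symm_apply_apply]) h.ne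
    · rw [SetLike.mem_coe, Ideal.mem_comap, vVar, aVar, mul_comm, htw]
      exact Y.mul_mem_left _ (hY.loop a j (by rw [hs, v.symm_apply_apply])
        (by rw [ht, v.symm_apply_apply]))
  · rintro _ ⟨a, a', h, rfl⟩
    rw [SetLike.mem_coe, Ideal.mem_comap, aVar, aVar, htw]
    exact Y.mul_mem_left _ (hY.arrows a a' fun h' => h
      ⟨(v.symm.injective h'.1).symm, (v.symm.injective h'.2).symm⟩)

end Twist

/-! ### Functionals with multiplicatively closed kernel -/

section CodimensionOne

open MvPolynomial

variable {k : Type*} [Field k] {Q₀ : Type*} [Quiver Q₀] [Fintype Q₀] {n₀ n₁ : ℕ}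
  (v : Fin (n₀ + 1) ≃ Q₀) (α : Fin n₁ ≃ Quiver.Total Q₀)

/-- The coordinates of a functional on `T₂Q`. -/
noncomputable def functionalCoord (ψ : Module.Dual k (T2 k Q₀)) (x : Fin n₀ ⊕ Fin n₁) : k :=
  ψ (gen k v α x)

theorem gen_eq_fullGen (x : Fin n₀ ⊕ Fin n₁) :
    gen k v α x = fullGen k v α (Sum.map Fin.succ id x) := by
  cases x <;> rfl

variable {ψ : Module.Dual k (T2 k Q₀)}

/-- The functional whose kernel is a subalgebra satisfies the relations. -/
theorem coneRelations_of_mul (hψ : ∀ a b, ψ a = 0 → ψ b = 0 → ψ (a * b) = 0) :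
    ConeRelations (fun j => v.symm (α j).left) (fun j => v.symm (α j).right)
      (RingHom.ker (eval (functionalCoord v α ψ))) := by
  -- The two factors lie in the kernel by construction; each cone relation comes from one choice of
  -- the four basis elements.
  have key : ∀ x x' z z', ψ ((ψ (fullGen k v α x') • fullGen k v α x -
      ψ (fullGen k v α x) • fullGen k v α x') * (ψ (fullGen k v α z') • fullGen k v α z -
      ψ (fullGen k v α z) • fullGen k v α z')) = 0 := by
    refine fun x x' z z' => hψ _ _ ?_ ?_ <;>
    · simp only [map_sub, map_smul, smul_eq_mul]
      ring
  -- Relations that involve an arrow arise multiplied by an extra factor, the value at that arrow,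
  -- which can be cancelled in a field.
  have sq : ∀ {a b : k}, a * a * b = 0 → a * b = 0 := by
    intro a b h
    simpa using h
  refine ⟨fun i j hij => ?_, fun i j l h1 h2 h3 => ?_, fun a i hs ht => ?_, fun a i hs ht => ?_,
    fun a i l hs ht hil => ?_, fun a a' haa => ?_⟩ <;>
    simp only [RingHom.mem_ker, map_mul, map_add, eval_X, functionalCoord, gen_eq_fullGen,
      Sum.map_inl, Sum.map_inr, id]
  · have hij' := (Fin.succ_injective n₀).ne hij
    have := key (.inl i.succ) (.inl j.succ) (.inl i.succ) (.inl j.succ)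
    simp only [sub_mul, mul_sub, smul_mul_smul_comm, fullGen_inl_mul_inl, if_true, if_neg hij',
      if_neg hij'.symm, map_sub, map_smul, smul_eq_mul, map_zero, smul_zero] at this
    linear_combination this
  · have h1 := (Fin.succ_injective n₀).ne h1
    have h2 := (Fin.succ_injective n₀).ne h2
    have h3 := (Fin.succ_injective n₀).ne h3
    have := key (.inl i.succ) (.inl j.succ) (.inl i.succ) (.inl l.succ)
    simp only [sub_mul, mul_sub, smul_mul_smul_comm, fullGen_inl_mul_inl, if_true, if_neg h2,
      if_neg h3, if_neg h1.symm, map_sub, map_smul, smul_eq_mul, map_zero,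
      smul_zero] at this
    linear_combination this
  · have := key (.inr a) (.inl i.succ) (.inr a) (.inl i.succ)
    simp only [sub_mul, mul_sub, smul_mul_smul_comm, fullGen_inl_mul_inl, fullGen_inl_mul_inr,
      fullGen_inr_mul_inl, fullGen_inr_mul_inr, if_true, if_neg hs.symm,
      if_neg ht.symm, map_sub, map_smul, smul_eq_mul, map_zero, smul_zero] at this
    exact sq (by linear_combination this)
  · have := key (.inr a) (.inl i.succ) (.inr a) (.inl i.succ)
    simp only [sub_mul, mul_sub, smul_mul_smul_comm, fullGen_inl_mul_inl, fullGen_inl_mul_inr,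
      fullGen_inr_mul_inl, fullGen_inr_mul_inr, if_true, if_pos hs.symm,
      if_pos ht.symm, map_sub, map_smul, smul_eq_mul, map_zero, smul_zero] at this
    exact sq (by linear_combination -this)
  · have hil' := (Fin.succ_injective n₀).ne hil
    have h1 : v.symm (α a).left ≠ i.succ := hs ▸ hil'.symm
    have h2 : v.symm (α a).right ≠ l.succ := ht ▸ hil'
    have := key (.inr a) (.inl l.succ) (.inr a) (.inl i.succ)
    simp only [sub_mul, mul_sub, smul_mul_smul_comm, fullGen_inl_mul_inl, fullGen_inl_mul_inr,
      fullGen_inr_mul_inl, fullGen_inr_mul_inr, if_pos hs.symm, if_neg hil'.symm,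
      if_pos ht.symm, map_sub, map_smul, smul_eq_mul, map_zero, smul_zero] at this
    exact sq (by linear_combination -this)
  -- If the sources agree the targets differ: right multiplication by the idempotent at the target
  -- of `a` fixes `a` and kills `a'`. Otherwise the idempotent at the source of `a` does this from
  -- the left.
  · by_cases hs : v.symm (α a').left = v.symm (α a).left
    · have ht : v.symm (α a').right ≠ v.symm (α a).right := fun h => haa ⟨hs, h⟩
      have := key (.inr a) (.inr a') (.inl (v.symm (α a).right)) (.inr a)
      simp only [sub_mul, mul_sub, smul_mul_smul_comm, fullGen_inr_mul_inl, fullGen_inr_mul_inr,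
        if_true, if_neg ht, map_sub, map_smul, smul_eq_mul, map_zero, smul_zero] at this
      exact sq (by linear_combination this)
    · have := key (.inl (v.symm (α a).left)) (.inr a) (.inr a) (.inr a')
      simp only [sub_mul, mul_sub, smul_mul_smul_comm, fullGen_inl_mul_inr, fullGen_inr_mul_inr,
        if_true, if_neg hs, map_sub, map_smul, smul_eq_mul, map_zero, smul_zero] at this
      exact sq (by linear_combination this)

/-- The value at the omitted vertex is forced: the idempotents sum to `1`, where `ψ` vanishes, and
the prescribed values sum to zero. -/
theorem functional_vertex (h1 : ψ 1 = 0) {s t : Fin (n₀ + 1)} {c : k}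
    (h : ∀ i, functionalCoord v α ψ (.inl i) = c * endCoef k s t i) (p : Fin (n₀ + 1)) :
    ψ (fullGen k v α (.inl p)) = c * ((if p = s then 1 else 0) - (if p = t then 1 else 0)) := by
  have hsucc : ∀ i : Fin n₀, ψ (fullGen k v α (.inl i.succ)) =
      c * ((if i.succ = s then 1 else 0) - (if i.succ = t then 1 else 0)) := h
  have hsum : ∑ p : Fin (n₀ + 1), c * ((if p = s then 1 else 0) - (if p = t then 1 else 0)) =
      (0 : k) := by
    rw [← Finset.mul_sum]
    simp
  rw [one_eq_sum_fullGen k v α, map_sum, Fin.sum_univ_succ] at h1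
  rw [Fin.sum_univ_succ, ← Finset.sum_congr rfl fun i _ => hsucc i] at hsum
  refine Fin.cases ?_ hsucc p
  linear_combination h1 - hsum

/-- The kernel of a functional which is, on a basis, a derivation with respect to two coordinate
functionals is closed under products. -/
theorem mul_eq_zero_of_basis {T ι : Type*} [Ring T] [Algebra k T] [DecidableEq ι]
    (b : Module.Basis ι k T) {φ : Module.Dual k T} (s t : ι)
    (h : ∀ x z, φ (b x * b z) =
      (if x = s then 1 else 0) * φ (b z) + φ (b x) * (if z = t then 1 else 0))
    {x z : T} (hx : φ x = 0) (hz : φ z = 0) : φ (x * z) = 0 := by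
  have hD : (LinearMap.mul k T).compr₂ φ =
      (LinearMap.mul k k).compl₁₂ (b.coord s) φ + (LinearMap.mul k k).compl₁₂ φ (b.coord t) := by
    refine LinearMap.ext_basis b b fun x z => ?_
    simpa [Finsupp.single_apply] using h x z
  have := congrArg (fun D : T →ₗ[k] T →ₗ[k] k => D x z) hD
  simpa [hx, hz] using this

/-- A functional on the cone is a derivation with respect to two characters. -/
theorem mul_of_onCone (h1 : ψ 1 = 0)
    (h : OnCone (fun j => v.symm (α j).left) (fun j => v.symm (α j).right)
      (functionalCoord v α ψ)) {a b : T2 k Q₀} (ha : ψ a = 0) (hb : ψ b = 0) :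
    ψ (a * b) = 0 := by
  obtain ⟨s, t, c, h0, harr⟩ := h
  have hv := functional_vertex v α h1 h0
  have harr' : ∀ j, ¬ (v.symm (α j).left = s ∧ v.symm (α j).right = t) →
      ψ (fullGen k v α (.inr j)) = 0 := harr
  refine mul_eq_zero_of_basis (fullBasis k v α) (.inl s) (.inl t) (fun x z => ?_) ha hb
  rw [fullBasis_apply, fullBasis_apply]
  rcases x with p | j <;> rcases z with q | l
  · rw [fullGen_inl_mul_inl, apply_ite ψ, map_zero, hv, hv]
    simp only [Sum.inl.injEq]
    by_cases hpq : p = q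
    · rw [if_pos hpq, hpq]
      split_ifs <;> ring
    -- The mixed terms of the derivation identity cancel, which leaves products of two indicators at
    -- one vertex; these vanish for `p ≠ q`.
    · have hne : ∀ r, ((if p = r then 1 else 0) * (if q = r then 1 else 0) : k) = 0 := by
        intro r
        by_cases hp : p = r
        · rw [if_neg (fun hq : q = r => hpq (hp.trans hq.symm)), mul_zero]
        · rw [if_neg hp, zero_mul]
      rw [if_neg hpq]
      linear_combination c * hne t - c * hne s
  · rw [fullGen_inl_mul_inr, apply_ite ψ, map_zero, hv]
    have := harr' l
    simp only [Sum.inl.injEq, reduceCtorEq, if_false, mul_zero, add_zero]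
    by_cases hl : v.symm (α l).left = s ∧ v.symm (α l).right = t
    · rw [hl.1]
      simp [eq_comm]
    · simp [this hl]
  · rw [fullGen_inr_mul_inl, apply_ite ψ, map_zero, hv]
    have := harr' j
    simp only [Sum.inl.injEq, reduceCtorEq, if_false, zero_mul, zero_add]
    by_cases hl : v.symm (α j).left = s ∧ v.symm (α j).right = t
    · rw [hl.2]
      simp [eq_comm]
    · simp [this hl]
  · simp [fullGen_inr_mul_inr]

variable {B : Type*} [Ring B] [Algebra k B]

/-- A functional with multiplicatively closed kernel vanishes at the products of two elements of
a space of nilpotent elements that is closed under squares. -/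
theorem functional_mul_eq_zero {φ : Module.Dual k B}
    (hφ : ∀ a b, φ a = 0 → φ b = 0 → φ (a * b) = 0) (n : Submodule k B)
    (hn : ∀ x ∈ n, IsNilpotent x) (hsq : ∀ x ∈ n, x * x ∈ n) {x y : B} (hx : x ∈ n) (hy : y ∈ n) :
    φ (x * y) = 0 := by
  by_cases hφ0 : φ = 0
  · simp [hφ0]
  obtain ⟨t, ht⟩ : ∃ t, φ t = 1 := by
    obtain ⟨e, he⟩ : ∃ e, φ e ≠ 0 := by
      by_contra! h
      exact hφ0 (LinearMap.ext h)
    exact ⟨(φ e)⁻¹ • e, by simp [he]⟩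
  -- Since `z - φ z • t` lies in the kernel, `z ↦ φ (a * z)` is a multiple of `φ`. Iteration shows
  -- that the factor is nilpotent, hence zero.
  have hleft : ∀ a ∈ n, φ a = 0 → ∀ z, φ (a * z) = 0 := by
    intro a han ha
    have h1 : ∀ z, φ (a * z) = φ (a * t) * φ z := by
      intro z
      have := hφ a (z - φ z • t) ha (by simp [ht])
      rw [mul_sub, mul_smul_comm, map_sub, map_smul, smul_eq_mul] at this
      linear_combination this
    have h2 : ∀ m : ℕ, φ (a ^ m * t) = φ (a * t) ^ m := by
      intro m
      induction m with
      | zero => simp [ht]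
      | succ m ih => rw [pow_succ', mul_assoc, h1, ih, pow_succ']
    obtain ⟨m, hm⟩ := hn a han
    have h3 := h2 m
    rw [hm, zero_mul, map_zero] at h3
    intro z
    rw [h1, eq_zero_of_pow_eq_zero h3.symm, zero_mul]
  have hright : ∀ a ∈ n, φ a = 0 → ∀ z, φ (z * a) = 0 := by
    intro a han ha
    have h1 : ∀ z, φ (z * a) = φ z * φ (t * a) := by
      intro z
      have := hφ (z - φ z • t) a (by simp [ht]) ha
      rw [sub_mul, smul_mul_assoc, map_sub, map_smul, smul_eq_mul] at this
      linear_combination this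
    have h2 : ∀ m : ℕ, φ (t * a ^ m) = φ (t * a) ^ m := by
      intro m
      induction m with
      | zero => simp [ht]
      | succ m ih => rw [pow_succ, ← mul_assoc, h1, ih, pow_succ]
    obtain ⟨m, hm⟩ := hn a han
    have h3 := h2 m
    rw [hm, mul_zero, map_zero] at h3
    intro z
    rw [h1, eq_zero_of_pow_eq_zero h3.symm, mul_zero]
  by_cases hx0 : φ x = 0
  · exact hleft x hx hx0 y
  have hxx : φ (x * x) = 0 := by
    -- The element `x * x - r • x` of `n` lies in the kernel, so by `hleft` multiplication by `x`
    -- acts as `r` on the values at powers of `x`; nilpotency of `x` gives `r = 0`.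
    set r := φ (x * x) / φ x with hr
    have ha0 : φ (x * x - r • x) = 0 := by
      rw [map_sub, map_smul, smul_eq_mul, hr, div_mul_cancel₀ _ hx0, sub_self]
    have hmul := hleft _ (sub_mem (hsq x hx) (n.smul_mem r hx)) ha0
    have hpow : ∀ i : ℕ, φ (x * x ^ i) = r ^ i * φ x := by
      intro i
      induction i with
      | zero => simp
      | succ i ih =>
        have := hmul (x ^ i)
        rw [sub_mul, smul_mul_assoc, map_sub, map_smul, smul_eq_mul, ih, mul_assoc,
          ← pow_succ'] at this
        linear_combination this
    obtain ⟨m, hm⟩ := hn x hx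
    have h3 := hpow m
    rw [hm, mul_zero, map_zero] at h3
    have hr0 : r = 0 := eq_zero_of_pow_eq_zero ((mul_eq_zero.1 h3.symm).resolve_right hx0)
    rw [hr, div_eq_zero_iff] at hr0
    exact hr0.resolve_right hx0
  -- Modulo a kernel element of `n`, which contributes nothing by `hright`, `y` is a multiple of
  -- `x`.
  have hy' : φ (y - (φ y / φ x) • x) = 0 := by
    rw [map_sub, map_smul, smul_eq_mul, div_mul_cancel₀ _ hx0, sub_self]
  have := hright _ (sub_mem hy (n.smul_mem _ hx)) hy' x
  rw [mul_sub, mul_smul_comm, map_sub, map_smul, hxx, smul_zero, sub_zero] at this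
  exact this

end CodimensionOne

/-! ### Hyperplanes as functionals up to scalars -/

section Hyperplane

variable {k : Type*} [Field k] {E : Type*} [AddCommGroup E] [Module k E]

theorem exists_smul_eq_of_ker_eq {φ χ : Module.Dual k E} (hφ : φ ≠ 0) (hχ : χ ≠ 0)
    (h : LinearMap.ker φ = LinearMap.ker χ) : ∃ c : k, c ≠ 0 ∧ χ = c • φ := by
  obtain ⟨e, he⟩ : ∃ e, φ e ≠ 0 := by
    by_contra! h
    exact hφ (LinearMap.ext h)
  have hχe : χ = (χ e / φ e) • φ := by
    ext x
    have h1 : x - (φ x / φ e) • e ∈ LinearMap.ker χ := by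
      rw [← h, LinearMap.mem_ker, map_sub, map_smul, smul_eq_mul, div_mul_cancel₀ _ he, sub_self]
    rw [LinearMap.mem_ker, map_sub, map_smul, sub_eq_zero] at h1
    rw [h1, LinearMap.smul_apply, smul_eq_mul, smul_eq_mul]
    ring
  refine ⟨_, fun h0 => hχ ?_, hχe⟩
  rw [hχe, h0, zero_smul]

variable {m : ℕ} [FiniteDimensional k E] (hE : Module.finrank k E = m + 1)

theorem kerPoint_eq_iff {φ χ : {φ : Module.Dual k E // φ ≠ 0}} :
    kerPoint hE φ = kerPoint hE χ ↔ ∃ c : k, c ≠ 0 ∧ χ.1 = c • φ.1 := by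
  refine ⟨fun h => exists_smul_eq_of_ker_eq φ.2 χ.2 (congrArg Subtype.val h), ?_⟩
  rintro ⟨c, hc, h⟩
  refine Subtype.ext ?_
  simp only [kerPoint, h]
  rw [LinearMap.ker_smul _ _ hc]

include hE in
theorem exists_functional {H : Submodule k E} (hH : Module.finrank k H = m) :
    ∃ φ : Module.Dual k E, φ ≠ 0 ∧ H = LinearMap.ker φ := by
  obtain ⟨φ, hφ⟩ := kerPoint_surjective hE ⟨H, hH⟩
  exact ⟨φ.1, φ.2, (congrArg Subtype.val hφ).symm⟩

include hE in
theorem finrank_ker_functional {φ : Module.Dual k E} (hφ : φ ≠ 0) :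
    Module.finrank k (LinearMap.ker φ) = m := (kerPoint hE ⟨φ, hφ⟩).2

end Hyperplane

/-! ### Minors of a frame as coordinates of a functional -/

section Coordinates

variable (k : Type*) [Field k] {Q₀ : Type*} [Quiver Q₀] [Fintype Q₀] {n₀ n₁ N : ℕ}
  (v : Fin (n₀ + 1) ≃ Q₀) (α : Fin n₁ ≃ Quiver.Total Q₀)

theorem linearIndependent_gen : LinearIndependent k (gen k v α) := by
  have : gen k v α = fullGen k v α ∘ Sum.map Fin.succ id := funext (gen_eq_fullGen v α)
  rw [this]
  exact (linearIndependent_fullGen k v α).comp _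
    (Sum.map_injective.2 ⟨Fin.succ_injective _, Function.injective_id⟩)

/-- The basis of `V` consisting of `(Q₀ ∖ {v 0}) ∪ Q₁`. -/
noncomputable def basisV : Module.Basis (Fin n₀ ⊕ Fin n₁) k (spanV k v α) :=
  Module.Basis.span (linearIndependent_gen k v α)

theorem basisV_apply (x : Fin n₀ ⊕ Fin n₁) : (basisV k v α x : T2 k Q₀) = gen k v α x :=
  congrArg Subtype.val (Module.Basis.span_apply (linearIndependent_gen k v α) x)

instance : FiniteDimensional k (spanV k v α) := .of_basis (basisV k v α)

include v α in
theorem finite_T2 : FiniteDimensional k (T2 k Q₀) := .of_basis (fullBasis k v α)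

theorem finrank_spanV (hN : n₀ + n₁ = N + 1) : Module.finrank k (spanV k v α) = N + 1 := by
  rw [Module.finrank_eq_card_basis (basisV k v α)]
  simpa using hN

include v α in
theorem finrank_T2 (hN : n₀ + n₁ = N + 1) : Module.finrank k (T2 k Q₀) = N + 1 + 1 := by
  rw [Module.finrank_eq_card_basis (fullBasis k v α)]
  simp
  omega

variable (n₀ n₁) in
/-- The change of signs on `k ^ ((Q₀ ∖ {v 0}) ∪ Q₁)`. -/
def signEquiv : (Fin n₀ ⊕ Fin n₁ → k) ≃ₗ[k] (Fin n₀ ⊕ Fin n₁ → k) where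
  toFun y x := sgn k n₀ n₁ x * y x
  invFun y x := sgn k n₀ n₁ x * y x
  map_add' y z := by ext x; simp [mul_add]
  map_smul' c y := by ext x; simp [mul_left_comm]
  left_inv y := by ext x; simp [← mul_assoc, sgn_mul_sgn]
  right_inv y := by ext x; simp [← mul_assoc, sgn_mul_sgn]

/-- The coordinates of a functional on `V`, with signs. -/
noncomputable def dualCoord : Module.Dual k (spanV k v α) ≃ₗ[k] (Fin n₀ ⊕ Fin n₁ → k) :=
  ((basisV k v α).constr k).symm ≪≫ₗ signEquiv k n₀ n₁

theorem dualCoord_apply (φ : Module.Dual k (spanV k v α)) (x : Fin n₀ ⊕ Fin n₁) :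
    dualCoord k v α φ x = sgn k n₀ n₁ x * φ (basisV k v α x) := rfl

theorem position_val (hN : n₀ + n₁ = N + 1) (x : Fin n₀ ⊕ Fin n₁) :
    (-1 : k) ^ (position hN x).val = sgn k n₀ n₁ x := by
  rcases x with i | j <;> simp [position, sgn]

variable {k}

/-- In the Laplace expansion along the first column, a basis vector, only the row of `x`
contributes; its cofactor is the minor with the sign of the position of `x`. -/
theorem det_eq_minors (hN : n₀ + n₁ = N + 1) (F : Matrix (Fin n₀ ⊕ Fin n₁) (Fin N) k)
    (x : Fin n₀ ⊕ Fin n₁) :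
    detFunctional ((basisV k v α).reindex (position hN)) (fun j => ∑ x, F x j • basisV k v α x)
      (basisV k v α x) = sgn k n₀ n₁ x * minors hN F x := by
  rw [detFunctional_apply, Module.Basis.det_apply, Matrix.det_succ_column_zero,
    Finset.sum_eq_single (position hN x)]
  · have h1 : ((basisV k v α).reindex (position hN)).toMatrix
        (Matrix.vecCons (basisV k v α x) fun j => ∑ x, F x j • basisV k v α x)
        (position hN x) 0 = 1 := by
      simp [Module.Basis.toMatrix_apply]
    rw [h1, mul_one, position_val, minors]
    congr 2
    ext r j
    simp only [Matrix.submatrix_apply, Module.Basis.toMatrix_apply, Matrix.cons_val_succ,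
      Module.Basis.repr_reindex_apply, Module.Basis.repr_sum_self, id]
  · intro r _ hr
    have : ((basisV k v α).reindex (position hN)).toMatrix
        (Matrix.vecCons (basisV k v α x) fun j => ∑ x, F x j • basisV k v α x) r 0 = 0 := by
      simp [Module.Basis.toMatrix_apply, hr.symm]
    rw [this, mul_zero, zero_mul]
  · simp

/-- The maximal minors of a frame of a hyperplane are the coordinates of its equation, up to
signs and a common factor. -/
theorem minors_eq_smul (hN : n₀ + n₁ = N + 1) {F : Matrix (Fin n₀ ⊕ Fin n₁) (Fin N) k}
    {φ : Module.Dual k (spanV k v α)} (hφ : φ ≠ 0) (hF : IsFrame v α F (LinearMap.ker φ)) :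
    ∃ c : k, c ≠ 0 ∧ minors hN F = c • dualCoord k v α φ := by
  set f : Fin N → spanV k v α := fun j => ∑ x, F x j • basisV k v α x with hf
  have hf' : (fun j => ∑ x, F x j • gen k v α x) = (spanV k v α).subtype ∘ f := by
    ext j
    simp [hf, basisV_apply]
  obtain ⟨h1, h2⟩ := hF
  rw [hf'] at h1 h2
  have hli : LinearIndependent k f := h1.of_comp
  have hspan : Submodule.span k (Set.range f) = LinearMap.ker φ := by
    rw [Set.range_comp, ← Submodule.map_span] at h2
    exact Submodule.map_injective_of_injective (spanV k v α).injective_subtype h2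
  have hE := finrank_spanV k v α hN
  obtain ⟨c, hc, h⟩ := exists_smul_eq_of_ker_eq hφ
    (detFunctional_ne_zero hE ((basisV k v α).reindex (position hN)) hli)
    (by rw [ker_detFunctional hE _ hli, hspan])
  refine ⟨c, hc, funext fun x => ?_⟩
  have h3 := congrArg (fun g : Module.Dual k (spanV k v α) => g (basisV k v α x)) h
  simp only [hf, det_eq_minors, LinearMap.smul_apply, smul_eq_mul] at h3
  rw [Pi.smul_apply, dualCoord_apply, smul_eq_mul]
  linear_combination sgn k n₀ n₁ x * h3 - minors hN F x * sgn_mul_sgn (k := k) x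

theorem exists_isFrame (W : Gr k (spanV k v α) N) :
    ∃ F : Matrix (Fin n₀ ⊕ Fin n₁) (Fin N) k, IsFrame v α F W.1 := by
  obtain ⟨f, rfl⟩ := frameSpan_surjective W
  refine ⟨fun x j => (basisV k v α).repr (f.1 j) x, ?_⟩
  have h : (fun j => ∑ x, (basisV k v α).repr (f.1 j) x • gen k v α x) =
      (spanV k v α).subtype ∘ f.1 := by
    ext j
    have := congrArg (spanV k v α).subtype ((basisV k v α).sum_repr (f.1 j))
    rw [map_sum] at this
    simp only [map_smul, Submodule.subtype_apply, basisV_apply] at this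
    exact this
  unfold IsFrame
  rw [h]
  refine ⟨f.2.map' _ (by simp), ?_⟩
  rw [Set.range_comp, ← Submodule.map_span]
  rfl

end Coordinates

/-! ### The Grassmannian of hyperplanes of `V` as projective space -/

section Projective

variable {k : Type*} [Field k] {Q₀ : Type*} [Quiver Q₀] [Fintype Q₀] {n₀ n₁ N : ℕ}
  (hN : n₀ + n₁ = N + 1) (v : Fin (n₀ + 1) ≃ Q₀) (α : Fin n₁ ≃ Quiver.Total Q₀)

/-- The Grassmannian of hyperplanes of `V` is a projective space by means of the minors. -/
theorem exists_minors_isIsomorphism :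
    ∃ Ψ : Gr k (spanV k v α) N → Projectivization k (Fin n₀ ⊕ Fin n₁ → k),
      (∀ (W : Gr k (spanV k v α) N) (F : Matrix (Fin n₀ ⊕ Fin n₁) (Fin N) k),
        IsFrame v α F W.1 →
          ∃ h : minors hN F ≠ 0, Ψ W = Projectivization.mk k (minors hN F) h) ∧
      IsIsomorphism (grassmannian k (spanV k v α) N)
        (projectiveSpace k (Fin n₀ ⊕ Fin n₁ → k)) Ψ := by
  have hE := finrank_spanV k v α hN
  let L := dualCoord k v α
  let P : {φ : Module.Dual k (spanV k v α) // φ ≠ 0} → {y : Fin n₀ ⊕ Fin n₁ → k // y ≠ 0} :=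
    fun φ => ⟨L φ.1, (LinearEquiv.map_ne_zero_iff L).2 φ.2⟩
  let P' : {y : Fin n₀ ⊕ Fin n₁ → k // y ≠ 0} → {φ : Module.Dual k (spanV k v α) // φ ≠ 0} :=
    fun y => ⟨L.symm y.1, (LinearEquiv.map_ne_zero_iff L.symm).2 y.2⟩
  have hPP' : ∀ y, P (P' y) = y := fun y => Subtype.ext (L.apply_symm_apply _)
  let M : {y : Fin n₀ ⊕ Fin n₁ → k // y ≠ 0} → Projectivization k (Fin n₀ ⊕ Fin n₁ → k) :=
    fun y => Projectivization.mk k y.1 y.2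
  let K := kerPoint hE
  -- `Ψ` uses an arbitrary functional for each hyperplane; `hΨ` shows independence of the choice, as
  -- functionals with the same kernel are proportional.
  choose sec hsec using kerPoint_surjective hE
  let Ψ : Gr k (spanV k v α) N → Projectivization k (Fin n₀ ⊕ Fin n₁ → k) := fun W => M (P (sec W))
  have hΨ : ∀ φ, Ψ (K φ) = M (P φ) := by
    intro φ
    obtain ⟨c, hc, h⟩ := (kerPoint_eq_iff hE).1 (hsec (K φ)).symm
    refine (Projectivization.mk_eq_mk_iff' k _ _ _ _).2 ⟨c, ?_⟩
    simp only [P, h, map_smul]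
  let Λ : Projectivization k (Fin n₀ ⊕ Fin n₁ → k) → Gr k (spanV k v α) N :=
    fun z => K (P' ⟨z.rep, z.rep_nonzero⟩)
  have hΛ : ∀ y, Λ (M y) = K (P' y) := by
    intro y
    obtain ⟨c, hc⟩ := Projectivization.exists_smul_eq_mk_rep k y.1 y.2
    refine ((kerPoint_eq_iff hE).2 ⟨c, c.ne_zero, ?_⟩).symm
    simp only [P', M, ← hc, Units.smul_def, map_smul]
  refine ⟨Ψ, fun W F hF => ?_, ?_, Λ, ?_, fun W => ?_, fun z => ?_⟩
  · obtain ⟨φ, rfl⟩ := kerPoint_surjective hE W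
    obtain ⟨c, hc, h⟩ := minors_eq_smul v α hN φ.2 hF
    have h0 : minors hN F ≠ 0 := by rw [h]; exact smul_ne_zero hc (P φ).2
    exact ⟨h0, (hΨ φ).trans ((Projectivization.mk_eq_mk_iff' k _ _ _ _).2
      ⟨c⁻¹, by rw [h, inv_smul_smul₀ hc]⟩)⟩
  · refine isMorphism_grassmannian hE ?_
    have : Ψ ∘ kerPoint hE = M ∘ P := funext hΨ
    rw [this]
    refine (isMorphism_quotient _ M).comp (isMorphism_iff.2 fun φ => ?_)
    exact (isPolyMap_linear L.toLinearMap).isMorphismAt_induced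
      (Filter.Eventually.of_forall fun _ => rfl)
  · refine isMorphism_quotient_iff ?_
    have : Λ ∘ M = kerPoint hE ∘ P' := funext hΛ
    rw [this]
    refine (isMorphism_kerPoint hE).comp (isMorphism_iff.2 fun φ => ?_)
    exact (isPolyMap_linear L.symm.toLinearMap).isMorphismAt_induced
      (Filter.Eventually.of_forall fun _ => rfl)
  · obtain ⟨φ, rfl⟩ := kerPoint_surjective hE W
    rw [hΨ φ, hΛ]
    exact congrArg K (Subtype.ext (L.symm_apply_apply _))
  · obtain ⟨y, hy, rfl⟩ : ∃ y, ∃ hy : y ≠ 0, z = M ⟨y, hy⟩ := ⟨z.rep, z.rep_nonzero, by simp [M]⟩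
    rw [hΛ, hΨ, hPP']

end Projective

/-! ### Homogeneous polynomials on the cone -/

section Vanishing

open MvPolynomial

variable {k : Type*} [Field k]

theorem eval_smul_of_isHomogeneous {σ : Type*} {f : MvPolynomial σ k} {d : ℕ}
    (hf : f.IsHomogeneous d) (c : k) (z : σ → k) : eval (c • z) f = c ^ d * eval z f := by
  rw [eval_eq, eval_eq, Finset.mul_sum]
  refine Finset.sum_congr rfl fun m hm => ?_
  have h1 : m.degree = d := by
    rw [← hf (mem_support_iff.1 hm), Finsupp.degree_eq_weight_one]
    rfl
  simp only [Pi.smul_apply, smul_eq_mul, mul_pow, Finset.prod_mul_distrib, Finset.prod_pow_eq_pow_sum]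
  rw [← Finsupp.degree_apply, h1]
  ring

variable {n₀ n₁ : ℕ} {src tgt : Fin n₁ → Fin (n₀ + 1)} {y : Fin n₀ ⊕ Fin n₁ → k}

theorem OnCone.smul (h : OnCone src tgt y) (c : k) : OnCone src tgt (c • y) := by
  obtain ⟨s, t, e, h1, h2⟩ := h
  exact ⟨s, t, c * e, fun i => by simp [h1, mul_assoc], fun j hj => by simp [h2 j hj]⟩

variable (src tgt) in
-- Every unit vector lies on the cone. A nonzero point is needed to treat the origin, in particular
-- to exclude nonzero constants from the vanishing ideal.
theorem exists_onCone_ne_zero (x : Fin n₀ ⊕ Fin n₁) :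
    ∃ y : Fin n₀ ⊕ Fin n₁ → k, OnCone src tgt y ∧ y ≠ 0 := by
  classical
  refine ⟨Pi.single x 1, ?_, by simp⟩
  rcases x with i | j
  · refine ⟨i.succ, 0, 1, fun l => ?_, fun j _ => by simp⟩
    by_cases h : l = i <;> simp [endCoef, h]
  · refine ⟨src j, tgt j, 0, fun l => by simp, fun l hl => ?_⟩
    have : l ≠ j := by rintro rfl; exact hl ⟨rfl, rfl⟩
    simp [this]

variable {Q₀ : Type*} [Quiver Q₀] (v : Fin (n₀ + 1) ≃ Q₀) (α : Fin n₁ ≃ Quiver.Total Q₀)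

theorem onCone_iff_le_ker :
    OnCone (fun j => v.symm (α j).left) (fun j => v.symm (α j).right) y ↔
      X0 k n₀ n₁ ⊔ Xhalf k v α ⊔ X1 k n₀ α ≤ RingHom.ker (eval (signEquiv k n₀ n₁ y)) := by
  have hs : ∀ f, eval (signEquiv k n₀ n₁ y) f = eval y (twist k n₀ n₁ f) := fun f =>
    (eval_twist y f).symm
  refine ⟨fun h f hf => ?_, fun h => ((coneRelations_comap_twist v α).mono fun f hf => ?_).onCone⟩
  · rw [RingHom.mem_ker, hs]
    exact le_comap_twist v α h.coneRelations hf
  · have := h hf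
    rwa [RingHom.mem_ker, hs, twist_twist] at this

theorem mem_of_vanishing [Infinite k] {f : MvPolynomial (Fin n₀ ⊕ Fin n₁) k}
    (hf : ∀ y, OnCone (fun j => v.symm (α j).left) (fun j => v.symm (α j).right) y →
      eval (signEquiv k n₀ n₁ y) f = 0) : f ∈ X0 k n₀ n₁ ⊔ Xhalf k v α ⊔ X1 k n₀ α := by
  have h := (coneRelations_comap_twist (k := k) v α).mem_of_cone (f := twist k n₀ n₁ f)
    fun y hy => (eval_twist y f).trans (hf y hy)
  rwa [Ideal.mem_comap, twist_twist] at h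

/-- All listed generators of `X` are homogeneous, of degree three or two, so the homogeneous members
of `S` already generate an ideal containing `X`. -/
theorem isHomogeneous_generators {S : Set (MvPolynomial (Fin n₀ ⊕ Fin n₁) k)}
    (hS : ∀ f ∈ X0 k n₀ n₁ ⊔ Xhalf k v α ⊔ X1 k n₀ α, f ∈ S) :
    X0 k n₀ n₁ ⊔ Xhalf k v α ⊔ X1 k n₀ α ≤
      Ideal.span {f | (∃ d : ℕ, f.IsHomogeneous d) ∧ f ∈ S} := by
  have hX : ∀ x : Fin n₀ ⊕ Fin n₁, (X x : MvPolynomial (Fin n₀ ⊕ Fin n₁) k).IsHomogeneous 1 :=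
    isHomogeneous_X k
  have hsign : ∀ m : ℕ, ((-1) ^ m : MvPolynomial (Fin n₀ ⊕ Fin n₁) k).IsHomogeneous 0 := by
    intro m
    have : ((-1) ^ m : MvPolynomial (Fin n₀ ⊕ Fin n₁) k) = C ((-1) ^ m) := by simp
    rw [this]
    exact isHomogeneous_C _ _
  have key : ∀ T : Set (MvPolynomial (Fin n₀ ⊕ Fin n₁) k),
      Ideal.span T ≤ X0 k n₀ n₁ ⊔ Xhalf k v α ⊔ X1 k n₀ α →
      (∀ f ∈ T, ∃ d : ℕ, f.IsHomogeneous d) →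
      Ideal.span T ≤ Ideal.span {f | (∃ d : ℕ, f.IsHomogeneous d) ∧ f ∈ S} := fun T h1 h2 =>
    Ideal.span_mono fun f hf => ⟨h2 f hf, hS f (h1 (Ideal.subset_span hf))⟩
  refine sup_le (sup_le (key _ (le_sup_left.trans le_sup_left) ?_)
    (key _ (le_sup_right.trans le_sup_left) ?_)) (key _ le_sup_right ?_)
  · rintro _ (⟨i, j, h, rfl⟩ | ⟨i, j, l, h, h', rfl⟩)
    · refine ⟨3, IsHomogeneous.sub (((hX _).pow 2).mul (hX _)) ?_⟩
      simpa [vVar] using (hsign (j.val - i.val - 1)).mul ((hX (.inl i)).mul ((hX (.inl j)).pow 2))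
    · exact ⟨_, ((hX _).mul (hX _)).mul (hX _)⟩
  · rintro _ ((⟨a, j, hs, ht, rfl⟩ | ⟨a, j, l, h, hst, rfl⟩) | ⟨a, j, hs, ht, rfl⟩)
    · exact ⟨_, (hX _).mul (hX _)⟩
    · refine ⟨_, IsHomogeneous.mul (IsHomogeneous.sub (hX _) ?_) (hX _)⟩
      simpa [vVar] using (hsign (l.val - j.val - 1)).mul (hX (.inl j))
    · exact ⟨_, (hX _).mul (hX _)⟩
  · rintro _ ⟨a, a', h, rfl⟩
    exact ⟨_, (hX _).mul (hX _)⟩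

end Vanishing

/-! ### The closed embedding of `msa(Q)` and its image -/

section Embedding

open MvPolynomial

variable {k : Type*} [Field k] {Q₀ : Type*} [Quiver Q₀] [Fintype Q₀] {n₀ n₁ N : ℕ}
  (hN : n₀ + n₁ = N + 1) (v : Fin (n₀ + 1) ≃ Q₀) (α : Fin n₁ ≃ Quiver.Total Q₀)

variable (k) in
/-- The projection of `T₂Q` onto `V` which kills `1`. -/
noncomputable def projV : T2 k Q₀ →ₗ[k] spanV k v α :=
  (fullBasis k v α).constr k (Sum.elim
    (Fin.cases (- ∑ i, basisV k v α (.inl i)) fun i => basisV k v α (.inl i))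
    fun j => basisV k v α (.inr j))

theorem projV_gen (x : Fin n₀ ⊕ Fin n₁) : projV k v α (gen k v α x) = basisV k v α x := by
  rw [gen_eq_fullGen, ← fullBasis_apply, projV, Module.Basis.constr_basis]
  rcases x with i | j <;> simp

theorem projV_one : projV k v α 1 = 0 := by
  rw [one_eq_sum_fullGen k v α, map_sum, Fin.sum_univ_succ]
  simp only [← fullBasis_apply, projV, Module.Basis.constr_basis]
  simp

theorem projV_subtype (x : spanV k v α) : projV k v α x = x := by
  have : projV k v α ∘ₗ (spanV k v α).subtype = LinearMap.id :=
    (basisV k v α).ext fun x => by simp [basisV_apply, projV_gen]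
  exact congrArg (fun g : spanV k v α →ₗ[k] spanV k v α => g x) this

/-- Both sides agree on `V` and vanish at `1`, and the two together span `T₂Q`. -/
theorem comp_projV {ψ : Module.Dual k (T2 k Q₀)} (h1 : ψ 1 = 0) :
    (ψ ∘ₗ (spanV k v α).subtype) ∘ₗ projV k v α = ψ := by
  refine (fullBasis k v α).ext fun x => ?_
  have hsucc : ∀ x, ψ (projV k v α (gen k v α x)) = ψ (gen k v α x) := fun x => by
    rw [projV_gen, basisV_apply]
  rw [fullBasis_apply]
  rcases x with p | j
  · refine Fin.cases ?_ (fun i => hsucc (.inl i)) p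
    rw [one_eq_sum_fullGen k v α, Fin.sum_univ_succ] at h1
    have h3 := congrArg (fun x : spanV k v α => ψ x) (projV_one (k := k) v α)
    rw [one_eq_sum_fullGen k v α, Fin.sum_univ_succ] at h3
    simp only [map_add, map_sum, Submodule.coe_add, Submodule.coe_sum, Submodule.coe_zero,
      map_zero] at h1 h3
    have h4 : ∑ i : Fin n₀, ψ (projV k v α (fullGen k v α (.inl i.succ))) =
        ∑ i : Fin n₀, ψ (fullGen k v α (.inl i.succ)) :=
      Finset.sum_congr rfl fun i _ => hsucc (.inl i)
    rw [h4] at h3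
    exact add_right_cancel (h3.trans h1.symm)
  · exact hsucc (.inr j)

/-- The coordinates of a functional on `V`. -/
noncomputable def coordV (φ : Module.Dual k (spanV k v α)) (x : Fin n₀ ⊕ Fin n₁) : k :=
  φ (basisV k v α x)

theorem functionalCoord_comp_projV (φ : Module.Dual k (spanV k v α)) :
    functionalCoord v α (φ ∘ₗ projV k v α) = coordV v α φ :=
  funext fun x => congrArg φ (projV_gen v α x)

/-- The subalgebra which is the kernel of a functional on the cone. -/
noncomputable def coneSubalgebra (φ : Module.Dual k (spanV k v α))
    (h : OnCone (fun j => v.symm (α j).left) (fun j => v.symm (α j).right) (coordV v α φ)) :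
    Subalgebra k (T2 k Q₀) :=
  have h1 : (φ ∘ₗ projV k v α) 1 = 0 := by rw [LinearMap.comp_apply, projV_one, map_zero]
  (LinearMap.ker (φ ∘ₗ projV k v α)).toSubalgebra h1 fun a b ha hb =>
    mul_of_onCone v α h1 (by rwa [functionalCoord_comp_projV]) ha hb

theorem comp_projV_ne_zero {φ : Module.Dual k (spanV k v α)} (hφ : φ ≠ 0) :
    φ ∘ₗ projV k v α ≠ 0 := by
  intro h
  refine hφ (LinearMap.ext fun x => ?_)
  have := congrArg (fun g : Module.Dual k (T2 k Q₀) => g x) h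
  simpa [projV_subtype] using this

include hN v α in
theorem finrank_T2_sub_one :
    Module.finrank k (T2 k Q₀) = (Module.finrank k (T2 k Q₀) - 1) + 1 := by
  rw [finrank_T2 k v α hN]
  rfl

include hN v α in
theorem exists_functional_msa (A : Msa k Q₀) : ∃ ψ : Module.Dual k (T2 k Q₀),
    ψ ≠ 0 ∧ Subalgebra.toSubmodule A.1 = LinearMap.ker ψ := by
  have := finite_T2 k v α
  exact exists_functional (finrank_T2_sub_one hN v α) A.2

/-- The intersection of a subalgebra of codimension one with `V`. -/
noncomputable def interV (A : Msa k Q₀) : Gr k (spanV k v α) N :=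
  ⟨(Subalgebra.toSubmodule A.1).comap (spanV k v α).subtype, by
    obtain ⟨ψ, hψ, hA⟩ := exists_functional_msa hN v α A
    have h1 : ψ 1 = 0 := by
      have : (1 : T2 k Q₀) ∈ Subalgebra.toSubmodule A.1 := A.1.one_mem
      rwa [hA] at this
    rw [hA, ← LinearMap.ker_comp]
    refine finrank_ker_functional (finrank_spanV k v α hN) fun h => hψ ?_
    rw [← comp_projV v α h1, h, LinearMap.zero_comp]⟩

/-- A subalgebra contains `1`, hence is recovered from its intersection with `V`. This gives
injectivity and describes the inverse as a preimage under a linear map. -/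
theorem comap_projV_interV (A : Msa k Q₀) :
    Subalgebra.toSubmodule A.1 = (interV hN v α A).1.comap (projV k v α) := by
  obtain ⟨ψ, hψ, hA⟩ := exists_functional_msa hN v α A
  have h1 : ψ 1 = 0 := by
    have : (1 : T2 k Q₀) ∈ Subalgebra.toSubmodule A.1 := A.1.one_mem
    rwa [hA] at this
  simp only [interV]
  rw [hA, ← LinearMap.ker_comp, ← LinearMap.ker_comp, comp_projV v α h1]

theorem kerPoint_mem_range_interV_iff (φ : {φ : Module.Dual k (spanV k v α) // φ ≠ 0}) :
    kerPoint (finrank_spanV k v α hN) φ ∈ Set.range (interV hN v α) ↔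
      OnCone (fun j => v.symm (α j).left) (fun j => v.symm (α j).right) (coordV v α φ.1) := by
  refine ⟨?_, fun h => ?_⟩
  · rintro ⟨A, hA⟩
    have hker : Subalgebra.toSubmodule A.1 = LinearMap.ker (φ.1 ∘ₗ projV k v α) := by
      rw [comap_projV_interV hN v α, hA, LinearMap.ker_comp]
      rfl
    rw [← functionalCoord_comp_projV]
    refine (coneRelations_of_mul v α fun a b ha hb => ?_).onCone
    have hmem : ∀ x, x ∈ A.1 ↔ (φ.1 ∘ₗ projV k v α) x = 0 := fun x => by
      rw [← LinearMap.mem_ker, ← hker, Subalgebra.mem_toSubmodule]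
    rw [← hmem] at ha hb ⊢
    exact A.1.mul_mem ha hb
  · have := finite_T2 k v α
    have hA : Subalgebra.toSubmodule (coneSubalgebra v α φ.1 h) =
        LinearMap.ker (φ.1 ∘ₗ projV k v α) := by
      ext x
      rfl
    refine ⟨⟨coneSubalgebra v α φ.1 h, ?_⟩, Subtype.ext ?_⟩
    · have := finrank_ker_functional (finrank_T2_sub_one hN v α) (comp_projV_ne_zero v α φ.2)
      rwa [← hA] at this
    · simp only [interV, kerPoint]
      rw [hA, ← LinearMap.ker_comp]
      congr 1
      ext x
      simp [projV_subtype]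

/-- The minors of every frame are a nonzero multiple of the signed coordinates of `φ`, and the cone
is stable under scaling, so the choice of the frame does not matter. -/
theorem kerPoint_mem_vanishingSet_iff (φ : {φ : Module.Dual k (spanV k v α) // φ ≠ 0}) :
    kerPoint (finrank_spanV k v α hN) φ ∈
        vanishingSet hN v α (X0 k n₀ n₁ ⊔ Xhalf k v α ⊔ X1 k n₀ α) ↔
      OnCone (fun j => v.symm (α j).left) (fun j => v.symm (α j).right) (coordV v α φ.1) := by
  have hcoord : ∀ c : k, c • dualCoord k v α φ.1 = signEquiv k n₀ n₁ (c • coordV v α φ.1) :=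
    fun c => by rw [map_smul]; rfl
  refine ⟨fun h => ?_, fun h f hf F hF => ?_⟩
  · obtain ⟨F, hF⟩ := exists_isFrame v α (kerPoint (finrank_spanV k v α hN) φ)
    obtain ⟨c, hc, hm⟩ := minors_eq_smul v α hN φ.2 hF
    have h1 : X0 k n₀ n₁ ⊔ Xhalf k v α ⊔ X1 k n₀ α ≤
        RingHom.ker (eval (signEquiv k n₀ n₁ (c • coordV v α φ.1))) := by
      intro f hf
      rw [← hcoord, ← hm]
      exact h f hf F hF
    have h2 := ((onCone_iff_le_ker v α).2 h1).smul c⁻¹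
    rwa [inv_smul_smul₀ hc] at h2
  · obtain ⟨c, hc, hm⟩ := minors_eq_smul v α hN φ.2 hF
    rw [hm, hcoord]
    exact (onCone_iff_le_ker v α).1 (h.smul c) hf

theorem range_interV :
    Set.range (interV hN v α) = vanishingSet hN v α (X0 k n₀ n₁ ⊔ Xhalf k v α ⊔ X1 k n₀ α) := by
  ext W
  obtain ⟨φ, rfl⟩ := kerPoint_surjective (finrank_spanV k v α hN) W
  rw [kerPoint_mem_range_interV_iff, kerPoint_mem_vanishingSet_iff]

theorem vanishingIdeal_range_interV [Infinite k] :
    vanishingIdeal hN v α (Set.range (interV hN v α)) =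
      X0 k n₀ n₁ ⊔ Xhalf k v α ⊔ X1 k n₀ α := by
  refine le_antisymm (Ideal.span_le.2 ?_) ?_
  · rintro f ⟨⟨d, hd⟩, hf⟩
    have key : ∀ y : Fin n₀ ⊕ Fin n₁ → k, y ≠ 0 →
        OnCone (fun j => v.symm (α j).left) (fun j => v.symm (α j).right) y →
        eval (signEquiv k n₀ n₁ y) f = 0 := by
      intro y hy hcone
      have hφ : (basisV k v α).constr k y ≠ 0 :=
        (LinearEquiv.map_ne_zero_iff ((basisV k v α).constr k)).2 hy
      have hcoord : coordV v α ((basisV k v α).constr k y) = y :=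
        funext fun x => Module.Basis.constr_basis _ _ _ _
      obtain ⟨F, hF⟩ := exists_isFrame v α (kerPoint (finrank_spanV k v α hN) ⟨_, hφ⟩)
      obtain ⟨c, hc, hm⟩ := minors_eq_smul v α hN hφ hF
      have h1 := hf _ ((kerPoint_mem_range_interV_iff hN v α ⟨_, hφ⟩).2 (by rwa [hcoord])) F hF
      have h2 : dualCoord k v α ((basisV k v α).constr k y) = signEquiv k n₀ n₁ y :=
        congrArg (signEquiv k n₀ n₁) hcoord
      rw [hm, h2, eval_smul_of_isHomogeneous hd] at h1
      exact (mul_eq_zero.1 h1).resolve_left (pow_ne_zero _ hc)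
    refine mem_of_vanishing v α fun y hy => ?_
    -- The origin is no point of the Grassmannian. By homogeneity the value there is `0 ^ d` times
    -- the value at a nonzero point of the cone, which also covers `d = 0`.
    by_cases h0 : y = 0
    · obtain ⟨y', hy', hne⟩ := exists_onCone_ne_zero (k := k) (fun j => v.symm (α j).left)
        (fun j => v.symm (α j).right) ((position hN).symm 0)
      have : y = (0 : k) • y' := by rw [h0, zero_smul]
      rw [this, map_smul, eval_smul_of_isHomogeneous hd, key y' hne hy', mul_zero]
    · exact key y h0 hy
  · refine isHomogeneous_generators v α
      (S := {f | ∀ W ∈ Set.range (interV hN v α), VanishesOn hN v α f W}) fun f hf W hW => ?_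
    rw [range_interV] at hW
    exact hW f hf

/-- Closedness in the quotient topology is tested on frames, hence on functionals by pulling back
along `frameFunctional`; there the locus is cut out by the polynomials in `X`. -/
theorem isClosed_range_interV :
    @IsClosed _ (grassmannian k (spanV k v α) N).top (Set.range (interV hN v α)) := by
  have hE := finrank_spanV k v α hN
  let _ := (puncturedDual k (spanV k v α)).top
  let _ := (frameSpace k (spanV k v α) N).top
  let _ := zariski k (Module.Dual k (spanV k v α))
  have h1 : IsClosed (kerPoint hE ⁻¹' Set.range (interV hN v α)) := by
    have : kerPoint hE ⁻¹' Set.range (interV hN v α) =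
        ⋂ f ∈ X0 k n₀ n₁ ⊔ Xhalf k v α ⊔ X1 k n₀ α,
          Subtype.val ⁻¹' {φ | eval (fun x => sgn k n₀ n₁ x * φ (basisV k v α x)) f = 0} := by
      ext φ
      rw [Set.mem_preimage, kerPoint_mem_range_interV_iff, onCone_iff_le_ker]
      simp only [Set.mem_iInter]
      rfl
    rw [this]
    refine isClosed_biInter fun f _ => IsClosed.preimage
      (continuous_induced_dom (f := Subtype.val)) (isClosed_zero ?_)
    refine ⟨aeval (fun x => C (sgn k n₀ n₁ x) * X (Module.Dual.eval k _ (basisV k v α x))) f,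
      fun φ => ?_⟩
    have : (eval fun l : Module.Dual k (Module.Dual k (spanV k v α)) => l φ).comp
        (aeval (R := k) (fun x => C (sgn k n₀ n₁ x) *
          X (Module.Dual.eval k _ (basisV k v α x)))).toRingHom =
        eval (fun x => sgn k n₀ n₁ x * φ (basisV k v α x)) := by
      refine ringHom_ext (fun r => ?_) fun x => ?_ <;> simp
    exact congrArg (fun g : MvPolynomial (Fin n₀ ⊕ Fin n₁) k →+* k => g f) this
  have h2 : frameSpan k (spanV k v α) N ⁻¹' Set.range (interV hN v α) =
      frameFunctional hE ⁻¹' (kerPoint hE ⁻¹' Set.range (interV hN v α)) := by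
    ext F
    simp only [Set.mem_preimage, kerPoint_frameFunctional]
  have h3 : IsClosed (frameSpan k (spanV k v α) N ⁻¹' Set.range (interV hN v α)) := by
    rw [h2]
    exact h1.preimage (isMorphism_frameFunctional hE).1
  exact isClosed_coinduced.2 h3

theorem isClosedEmbedding_interV :
    IsClosedEmbeddingOfVarieties (msa k Q₀) (grassmannian k (spanV k v α) N) (interV hN v α) := by
  have := finite_T2 k v α
  have hE := finrank_T2_sub_one (k := k) hN v α
  have hE' := finrank_spanV k v α hN
  choose inv hinv using fun W : Set.range (interV (k := k) hN v α) => W.2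
  have hinj : Function.Injective (interV (k := k) hN v α) := fun A A' h =>
    Subtype.ext (Subalgebra.toSubmodule_injective (by
      rw [comap_projV_interV hN v α A, comap_projV_interV hN v α A', h]))
  refine ⟨isClosed_range_interV hN v α, ?_, inv, ?_, fun A => ?_, fun W => ?_⟩
  · exact isMorphism_comap (k := k) hE hE' (i := AlgGr.toGr k (T2 k Q₀) _) (spanV k v α).subtype fun _ => rfl
  · refine isMorphism_comap hE' hE (j := AlgGr.toGr k (T2 k Q₀) _) (projV k v α) fun W => ?_
    rw [← hinv W]
    exact comap_projV_interV hN v α (inv W)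
  · exact hinj (hinv _)
  · exact Subtype.ext (hinv W)

end Embedding

/-! ### Admissible ideals -/

section Admissible

variable {k : Type*} [Field k] {Q₀ : Type*} [Quiver Q₀] [Fintype Q₀]

/-- A subalgebra of codimension one of `kQ / I` contains the image of `J ^ 2`. -/
theorem functional_eq_zero_of_factor {I : Ideal (PathAlgebra k Q₀)} [I.IsTwoSided]
    (hI : IsAdmissible I) {φ : Module.Dual k (PathAlgebra k Q₀ ⧸ I)}
    (hφ : ∀ a b, φ a = 0 → φ b = 0 → φ (a * b) = 0) {z : PathAlgebra k Q₀ ⧸ I}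
    (hz : Ideal.Quotient.factorₐ k hI.le_sq z = 0) : φ z = 0 := by
  obtain ⟨w, rfl⟩ := Ideal.Quotient.mk_surjective z
  rw [Ideal.Quotient.factorₐ_apply_mk, Ideal.Quotient.eq_zero_iff_mem] at hz
  obtain ⟨l, -, hl⟩ := hI.pow_le
  rw [show (2 : ℕ) = 1 + 1 from rfl, Submodule.pow_succ, Submodule.pow_one] at hz
  -- The image of `J` consists of nilpotent elements because `J ^ l ≤ I`, and it is closed under
  -- squares.
  let n : Submodule k (PathAlgebra k Q₀ ⧸ I) :=
    ((arrowIdeal k Q₀).restrictScalars k).map (Ideal.Quotient.mkₐ k I).toLinearMap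
  refine Submodule.mul_induction_on (C := fun w => φ (Ideal.Quotient.mk I w) = 0) hz
    (fun x hx y hy => ?_) fun x y hx hy => by rw [map_add, map_add, hx, hy, add_zero]
  rw [map_mul]
  refine functional_mul_eq_zero hφ n ?_ ?_ ⟨x, hx, rfl⟩ ⟨y, hy, rfl⟩
  · rintro _ ⟨x, hx, rfl⟩
    refine ⟨l, ?_⟩
    change Ideal.Quotient.mk I x ^ l = 0
    rw [← map_pow]
    exact Ideal.Quotient.eq_zero_iff_mem.2 (hl (Ideal.pow_mem_pow hx l))
  · rintro _ ⟨x, hx, rfl⟩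
    exact ⟨x * x, (arrowIdeal k Q₀).mul_mem_left x hx, map_mul (Ideal.Quotient.mkₐ k I) x x⟩

/-- Since subalgebras of codimension one contain the kernel of the projection `π`, the image under
`π` equals the preimage under any linear section `s`. Thus the map and its inverse are both
instances of `isMorphism_comap`. -/
theorem exists_factor_isIsomorphism [FiniteDimensional k (T2 k Q₀)] [Finite (Quiver.Total Q₀)]
    (hT : 0 < Module.finrank k (T2 k Q₀))
    (I : Ideal (PathAlgebra k Q₀)) [I.IsTwoSided] (hI : IsAdmissible I) :
    ∃ Θ : AlgGr k (PathAlgebra k Q₀ ⧸ I) (Module.finrank k (PathAlgebra k Q₀ ⧸ I) - 1) →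
        Msa k Q₀,
      (∀ A, (Θ A).1 = A.1.map (Ideal.Quotient.factorₐ k hI.le_sq)) ∧
      IsIsomorphism
        (algGr k (PathAlgebra k Q₀ ⧸ I) (Module.finrank k (PathAlgebra k Q₀ ⧸ I) - 1))
        (msa k Q₀) Θ := by
  have : FiniteDimensional k (PathAlgebra k Q₀ ⧸ I) := finite_quotient I hI.pow_le.choose_spec.2
  set π := Ideal.Quotient.factorₐ k hI.le_sq with hπ
  have hsurj : Function.Surjective π.toLinearMap := Ideal.Quotient.factor_surjective hI.le_sq
  obtain ⟨s, hs⟩ := π.toLinearMap.exists_rightInverse_of_surjective (LinearMap.range_eq_top.2 hsurj)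
  have hs' : ∀ x, π (s x) = x := fun x => congrArg (fun g : T2 k Q₀ →ₗ[k] T2 k Q₀ => g x) hs
  have hE : Module.finrank k (T2 k Q₀) = (Module.finrank k (T2 k Q₀) - 1) + 1 := by omega
  have hE' : Module.finrank k (PathAlgebra k Q₀ ⧸ I) =
      (Module.finrank k (PathAlgebra k Q₀ ⧸ I) - 1) + 1 := by
    have := LinearMap.finrank_le_finrank_of_surjective (f := π.toLinearMap) hsurj
    exact (Nat.sub_add_cancel (hT.trans_le this)).symm
  have hker : ∀ (A : AlgGr k (PathAlgebra k Q₀ ⧸ I)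
      (Module.finrank k (PathAlgebra k Q₀ ⧸ I) - 1)) (z), π z = 0 → z ∈ A.1 := by
    intro A z hz
    obtain ⟨φ, -, hA⟩ := exists_functional hE' (H := Subalgebra.toSubmodule A.1) A.2
    have hmem : ∀ x, x ∈ A.1 ↔ φ x = 0 := fun x => by
      rw [← Subalgebra.mem_toSubmodule, hA, LinearMap.mem_ker]
    rw [hmem]
    refine functional_eq_zero_of_factor hI (fun a b ha hb => ?_) hz
    rw [← hmem] at ha hb ⊢
    exact A.1.mul_mem ha hb
  have hmap : ∀ A : AlgGr k (PathAlgebra k Q₀ ⧸ I)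
      (Module.finrank k (PathAlgebra k Q₀ ⧸ I) - 1),
      Subalgebra.toSubmodule (A.1.map π) = (Subalgebra.toSubmodule A.1).comap s := by
    intro A
    ext x
    simp only [Subalgebra.mem_toSubmodule, Subalgebra.mem_map, Submodule.mem_comap]
    refine ⟨?_, fun h => ⟨s x, h, hs' x⟩⟩
    rintro ⟨a, ha, rfl⟩
    have := hker A (s (π a) - a) (by rw [map_sub, hs', sub_self])
    simpa using add_mem this ha
  have hrank : ∀ A : AlgGr k (PathAlgebra k Q₀ ⧸ I)
      (Module.finrank k (PathAlgebra k Q₀ ⧸ I) - 1),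
      Module.finrank k (Subalgebra.toSubmodule (A.1.map π)) =
        Module.finrank k (T2 k Q₀) - 1 := by
    intro A
    obtain ⟨φ, hφ, hA⟩ := exists_functional hE' (H := Subalgebra.toSubmodule A.1) A.2
    rw [hmap, hA, ← LinearMap.ker_comp]
    refine finrank_ker_functional hE fun h => hφ (LinearMap.ext fun x => ?_)
    have h1 : x - s (π x) ∈ Subalgebra.toSubmodule A.1 :=
      hker A _ (by rw [map_sub, hs', sub_self])
    rw [hA, LinearMap.mem_ker, map_sub, sub_eq_zero] at h1
    rw [h1]
    exact congrArg (fun g : Module.Dual k (T2 k Q₀) => g (π x)) h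
  have hrank' : ∀ A : Msa k Q₀, Module.finrank k (Subalgebra.toSubmodule (A.1.comap π)) =
        Module.finrank k (PathAlgebra k Q₀ ⧸ I) - 1 := by
    intro A
    obtain ⟨ψ, hψ, hA⟩ := exists_functional hE (H := Subalgebra.toSubmodule A.1) A.2
    have : Subalgebra.toSubmodule (A.1.comap π) = LinearMap.ker (ψ ∘ₗ π.toLinearMap) := by
      rw [LinearMap.ker_comp, ← hA]
      rfl
    rw [this]
    refine finrank_ker_functional hE' fun h => hψ (LinearMap.ext fun x => ?_)
    obtain ⟨z, rfl⟩ := hsurj x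
    exact congrArg (fun g : Module.Dual k (PathAlgebra k Q₀ ⧸ I) => g z) h
  refine ⟨fun A => ⟨A.1.map π, hrank A⟩, fun A => rfl, ?_, fun A => ⟨A.1.comap π, hrank' A⟩, ?_,
    fun A => Subtype.ext ?_, fun A => Subtype.ext ?_⟩
  · exact isMorphism_comap hE' hE (i := AlgGr.toGr k (PathAlgebra k Q₀ ⧸ I) _)
      (j := AlgGr.toGr k (T2 k Q₀) _) s hmap
  · exact isMorphism_comap hE hE' (i := AlgGr.toGr k (T2 k Q₀) _)
      (j := AlgGr.toGr k (PathAlgebra k Q₀ ⧸ I) _) π.toLinearMap fun _ => rfl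
  · ext x
    refine ⟨?_, fun h => ⟨x, h, rfl⟩⟩
    rintro ⟨a, ha, hax⟩
    have := hker A (x - a) (by rw [map_sub, sub_eq_zero]; exact hax.symm)
    simpa using add_mem this ha
  · ext x
    refine ⟨?_, fun h => ?_⟩
    · rintro ⟨a, ha, rfl⟩
      exact ha
    · obtain ⟨z, rfl⟩ := hsurj x
      exact ⟨z, h, rfl⟩

end Admissible

end SubalgebraVariety

theorem theoremt {k : Type*} [Field k] [IsAlgClosed k] {Q₀ : Type*} [Quiver Q₀] [Fintype Q₀]
    (n₀ n₁ N : ℕ) (hN : n₀ + n₁ = N + 1)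
    (v : Fin (n₀ + 1) ≃ Q₀) (α : Fin n₁ ≃ Quiver.Total Q₀) :
    -- the closed embedding, its image, and the homogeneous vanishing ideal of its image
    (∃ Φ : Msa k Q₀ → Gr k (spanV k v α) N,
      (∀ A : Msa k Q₀, (Φ A).1 =
        (Subalgebra.toSubmodule A.1).comap (spanV k v α).subtype) ∧
      IsClosedEmbeddingOfVarieties (msa k Q₀) (grassmannian k (spanV k v α) N) Φ ∧
      Set.range Φ = vanishingSet hN v α (X0 k n₀ n₁ ⊔ Xhalf k v α ⊔ X1 k n₀ α) ∧
      vanishingIdeal hN v α (Set.range Φ) = X0 k n₀ n₁ ⊔ Xhalf k v α ⊔ X1 k n₀ α) ∧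
    -- the Grassmannian is the projective space of dimension `N`, by means of the maximal minors
    (∃ Ψ : Gr k (spanV k v α) N → Projectivization k (Fin n₀ ⊕ Fin n₁ → k),
      (∀ (W : Gr k (spanV k v α) N) (F : Matrix (Fin n₀ ⊕ Fin n₁) (Fin N) k),
        IsFrame v α F W.1 →
          ∃ h : minors hN F ≠ 0, Ψ W = Projectivization.mk k (minors hN F) h) ∧
      IsIsomorphism (grassmannian k (spanV k v α) N)
        (projectiveSpace k (Fin n₀ ⊕ Fin n₁ → k)) Ψ) ∧
    -- the same variety for every admissible ideal
    (∀ (I : Ideal (PathAlgebra k Q₀)) [I.IsTwoSided] (hI : IsAdmissible I),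
      ∃ Θ : AlgGr k (PathAlgebra k Q₀ ⧸ I) (Module.finrank k (PathAlgebra k Q₀ ⧸ I) - 1) →
          Msa k Q₀,
        (∀ A, (Θ A).1 = A.1.map (Ideal.Quotient.factorₐ k hI.le_sq)) ∧
        IsIsomorphism
          (algGr k (PathAlgebra k Q₀ ⧸ I) (Module.finrank k (PathAlgebra k Q₀ ⧸ I) - 1))
          (msa k Q₀) Θ) := by
  refine ⟨⟨interV hN v α, fun _ => rfl, isClosedEmbedding_interV hN v α, range_interV hN v α,
    vanishingIdeal_range_interV hN v α⟩, exists_minors_isIsomorphism hN v α, fun I _ hI => ?_⟩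
  have := finite_T2 k v α
  have := Finite.of_equiv _ α
  exact exists_factor_isIsomorphism (by rw [finrank_T2 k v α hN]; omega) I hI
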